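/- **Theorem (weighted sampling).** Let $A=A_1+\cdots+A_\tau\in\mathbb{C}^{n\times n}$, where each $A_\ell\in\mathbb{C}^{n\times n}$ is Hermitian with spectral norm $\|A_\ell\|\le 1$ and $\operatorname{rank}(A_\ell)\le r$, and not all $A_\ell$ are zero. Let $\epsilon>0$ and put $$p=\left\lceil 2\cdot 10^{20}\,\frac{\tau^{12}r^{19}}{\epsilon^{6}}\right\rceil,\qquad \gamma=\frac{\epsilon^2}{3\cdot 10^6\,\tau^2r^6}.$$ For a vector $v\neq0$ let $\mathcal{D}_v(i)=|v(i)|^2/\|v\|^2$, and let $\mathrm{rows}(M)$ be the vector of Euclidean norms of the rows of $M$. (Terms below with a zero vector $v$ have weight $0$ and are omitted.) Run the following procedure. 1. Sample $i_1,\dots,i_p\in[n]$ independently with law $$P_i=\sum_{\ell=1}^{\tau}\mathcal{D}_{\mathrm{rows}(A_\ell)}(i)\,\frac{\|A_\ell\|_F^2}{\sum_{\ell'}\|A_{\ell'}\|_F^2}.$$ Let $S_\ell\in\mathbb{C}^{p\times n}$ have rows $S_\ell(t,\cdot)=A_\ell(i_t,\cdot)/\sqrt{pP_{i_t}}$, and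 let $S=\sum_\ell S_\ell$. 2. Given $i_1,\dots,i_p$, sample $j_1,\dots,j_p\in[n]$ independently, each by drawing $t\in[p]$ uniformly and then drawing $j$ with probability $$Q_{j|i_t}=\sum_{k=1}^{\tau}\mathcal{D}_{A_k(i_t,\cdot)}(j)\,\frac{\|A_k(i_t,\cdot)\|^2}{\sum_{\ell}\|A_{\ell}(i_t,\cdot)\|^2};$$ so each $j_s$ has law $P'_j=\frac1p\sum_{t=1}^pQ_{j|i_t}$. Let $W_\ell\in\mathbb{C}^{p\times p}$ have columns $W_\ell(\cdot,t)=S_\ell(\cdot,j_t)/\sqrt{pP'_{j_t}}$, and let $W=\sum_\ell W_\ell$. 3. Take the top $\operatorname{rank}(A)$ singular values of $W$ (all $p$ of them if $p<\operatorname{rank}(A)$), with corresponding orthonormal left singular vectors, from a singular value decomposition of $W$, and discard those with $\sigma_j^2<\gamma\sum_\ell\|W_\ell\|_F^2$. Let $\sigma_1,\dots,\sigma_{\tilde r}$ and $u_1,\dots,u_{\tilde r}\in\mathbb{C}^p$ be the remaining ones, and let $V\in\mathbb{C}^{n\times\tilde r}$ be the matrix with columns $V(\cdot,j)=S^\dagger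 u_j/\sigma_j$. Then, with probability at least $9/10$ over the sampled indices, for every choice of the singular value decomposition of $W$, $$\|VV^\dagger AVV^\dagger-A\|_F\le\frac{\epsilon}{300r^2}\left(2+\frac{\epsilon}{300r^2(\tau+1)}\right).$$ -/

import Mathlib

-- Throughout, the norm of a matrix, `‖M‖`, is the Frobenius norm.
open scoped Matrix Matrix.Norms.Frobenius

noncomputable section

namespace WeightedSampling

/-- The length-square distribution `𝒟_v(i) = |v(i)|² / ‖v‖²` of a vector `v` (Euclidean norm). -/
def lengthSquared {𝕜 : Type} [RCLike 𝕜] {n : ℕ} (v : EuclideanSpace 𝕜 (Fin n)) (i : Fin n) : ℝ :=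
  ‖v i‖ ^ 2 / ‖v‖ ^ 2

/-- The row `M(i, ·)` as a vector with its Euclidean norm. -/
def rowVec {m n : ℕ} (M : Matrix (Fin m) (Fin n) ℂ) (i : Fin m) : EuclideanSpace ℂ (Fin n) :=
  WithLp.toLp 2 (M i)

/-- `rows(M)`: the vector of the Euclidean norms of the rows of `M`. -/
def rowNorms {m n : ℕ} (M : Matrix (Fin m) (Fin n) ℂ) : EuclideanSpace ℝ (Fin m) :=
  WithLp.toLp 2 fun i => ‖rowVec M i‖

/-- Weighted row sampling: the probability `P_i` of the row index `i` when first `ℓ` is drawn with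
probability `‖A_ℓ‖_F² / ∑_ℓ' ‖A_ℓ'‖_F²`, and then `i` is drawn from `𝒟_{rows(A_ℓ)}`. -/
def rowProb {τ n : ℕ} (A : Fin τ → Matrix (Fin n) (Fin n) ℂ) (i : Fin n) : ℝ :=
  ∑ ℓ, lengthSquared (rowNorms (A ℓ)) i * (‖A ℓ‖ ^ 2 / ∑ ℓ', ‖A ℓ'‖ ^ 2)

/-- `Q_{j|i}`: the probability of the column index `j`, given the row index `i`, when first `k` is
drawn with probability `‖A_k(i, ·)‖² / ∑_ℓ ‖A_ℓ(i, ·)‖²`, and then `j` from `𝒟_{A_k(i, ·)}`. -/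
def condColProb {τ n : ℕ} (A : Fin τ → Matrix (Fin n) (Fin n) ℂ) (i j : Fin n) : ℝ :=
  ∑ k, lengthSquared (rowVec (A k) i) j * (‖rowVec (A k) i‖ ^ 2 / ∑ ℓ, ‖rowVec (A ℓ) i‖ ^ 2)

/-- Weighted column sampling: the probability `P'_j` of the column index `j` when first `t ∈ [p]`
is drawn uniformly, and then `j` is drawn from `Q_{· | i_t}`. -/
def colProb {τ n p : ℕ} (A : Fin τ → Matrix (Fin n) (Fin n) ℂ) (i : Fin p → Fin n) (j : Fin n) :
    ℝ :=
  ∑ t, 1 / (p : ℝ) * condColProb A (i t) j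

/-- The probability of the outcome `((i_1, …, i_p), (j_1, …, j_p))` of the two sampling procedures:
the `i_s` are independent with law `P`; given them, the `j_t` are independent with law `P'`. -/
def outcomeProb {τ n p : ℕ} (A : Fin τ → Matrix (Fin n) (Fin n) ℂ)
    (ω : (Fin p → Fin n) × (Fin p → Fin n)) : ℝ :=
  (∏ s, rowProb A (ω.1 s)) * ∏ t, colProb A ω.1 (ω.2 t)

open Classical in
/-- The probability of an event `E` about the outcome of the two sampling procedures, with `p`
row indices and `p` column indices. -/
def prob {τ n p : ℕ} (A : Fin τ → Matrix (Fin n) (Fin n) ℂ)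
    (E : (Fin p → Fin n) × (Fin p → Fin n) → Prop) : ℝ :=
  ∑ ω, if E ω then outcomeProb A ω else 0

/-- `S_ℓ(t, ·) = A_ℓ(i_t, ·) / √(p P_{i_t})`. -/
def matS {τ n p : ℕ} (A : Fin τ → Matrix (Fin n) (Fin n) ℂ) (i : Fin p → Fin n) (ℓ : Fin τ) :
    Matrix (Fin p) (Fin n) ℂ :=
  Matrix.of fun t k => A ℓ (i t) k / (√((p : ℝ) * rowProb A (i t)) : ℝ)

/-- `W_ℓ(·, t) = S_ℓ(·, j_t) / √(p P'_{j_t})`. -/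
def matW {τ n p : ℕ} (A : Fin τ → Matrix (Fin n) (Fin n) ℂ) (i j : Fin p → Fin n) (ℓ : Fin τ) :
    Matrix (Fin p) (Fin p) ℂ :=
  Matrix.of fun s t => matS A i ℓ s (j t) / (√((p : ℝ) * colProb A i (j t)) : ℝ)

/-- `W = X diag(σ) Y†` is a singular value decomposition: `X` and `Y` are unitary and
`σ_1 ≥ σ_2 ≥ … ≥ σ_p ≥ 0`. The columns of `X` are left singular vectors for the `σ_j`. -/
structure IsSVD {p : ℕ} (W X Y : Matrix (Fin p) (Fin p) ℂ) (σ : Fin p → ℝ) : Prop where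
  left_unitary : X ∈ Matrix.unitaryGroup (Fin p) ℂ
  right_unitary : Y ∈ Matrix.unitaryGroup (Fin p) ℂ
  nonneg : ∀ k, 0 ≤ σ k
  antitone : Antitone σ
  eq_mul : W = X * Matrix.diagonal (fun k => (σ k : ℂ)) * Yᴴ

/-- The sample size `p = 2·10²⁰ τ¹² r¹⁹ / ε⁶`, rounded up to an integer. -/
def sampleSize (τ r : ℕ) (ε : ℝ) : ℕ :=
  ⌈2 * 10 ^ 20 * ((τ : ℝ) ^ 12 * (r : ℝ) ^ 19 / ε ^ 6)⌉₊

/-- The threshold parameter `γ = ε² / (3·10⁶ τ² r⁶)`. -/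
def threshold (τ r : ℕ) (ε : ℝ) : ℝ :=
  ε ^ 2 / (3 * 10 ^ 6 * (τ : ℝ) ^ 2 * (r : ℝ) ^ 6)

/-- The indices that the algorithm keeps: those of the top `rank A` singular values of `W`
(`A = ∑ A_ℓ`), without those that satisfy `σ_k² < γ ∑_ℓ ‖W_ℓ‖_F²`. -/
def Kept {τ n p : ℕ} (A : Fin τ → Matrix (Fin n) (Fin n) ℂ) (γ : ℝ) (i j : Fin p → Fin n)
    (σ : Fin p → ℝ) : Type :=
  {k : Fin p // (k : ℕ) < (∑ ℓ, A ℓ).rank ∧ ¬ σ k ^ 2 < γ * ∑ ℓ, ‖matW A i j ℓ‖ ^ 2}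

instance {τ n p : ℕ} (A : Fin τ → Matrix (Fin n) (Fin n) ℂ) (γ : ℝ) (i j : Fin p → Fin n)
    (σ : Fin p → ℝ) : Fintype (Kept A γ i j σ) := by
  classical
  unfold Kept
  infer_instance

/-- The matrix `V` with columns `V(·, k) = S† u_k / σ_k` for the kept indices `k`, where
`S = ∑ S_ℓ` and `u_k = X(·, k)`. -/
def matV {τ n p : ℕ} (A : Fin τ → Matrix (Fin n) (Fin n) ℂ) (γ : ℝ) (i j : Fin p → Fin n)
    (σ : Fin p → ℝ) (X : Matrix (Fin p) (Fin p) ℂ) : Matrix (Fin n) (Kept A γ i j σ) ℂ :=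
  Matrix.of fun a k => ((∑ ℓ, matS A i ℓ)ᴴ *ᵥ X.col k.1) a / (σ k.1 : ℂ)

/-! The weights form a probability distribution unless all `A_ℓ` vanish. -/

theorem frob_sq {m n : ℕ} (M : Matrix (Fin m) (Fin n) ℂ) :
    ‖M‖ ^ 2 = ∑ i, ‖rowVec M i‖ ^ 2 := by
  rw [Matrix.frobenius_norm_def, ← Real.sqrt_eq_rpow, Real.sq_sqrt (by positivity)]
  simp [rowVec, EuclideanSpace.norm_sq_eq]

theorem rowProb_eq {τ n : ℕ} (A : Fin τ → Matrix (Fin n) (Fin n) ℂ) (i : Fin n) :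
    rowProb A i = (∑ ℓ, ‖rowVec (A ℓ) i‖ ^ 2) / ∑ ℓ, ‖A ℓ‖ ^ 2 := by
  rw [rowProb, Finset.sum_div]
  refine Finset.sum_congr rfl fun ℓ _ => ?_
  have h : ‖rowNorms (A ℓ)‖ ^ 2 = ‖A ℓ‖ ^ 2 := by
    rw [frob_sq]; simp [rowNorms, EuclideanSpace.norm_sq_eq]
  simp only [lengthSquared, h]
  by_cases h0 : ‖A ℓ‖ ^ 2 = 0
  · have h1 : ‖rowVec (A ℓ) i‖ ^ 2 = 0 :=
      (Finset.sum_eq_zero_iff_of_nonneg (fun _ _ => by positivity)).1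
        ((frob_sq (A ℓ)).symm.trans h0) i (Finset.mem_univ i)
    simp [h0, h1]
  · rw [div_mul_div_comm, mul_comm (‖A ℓ‖ ^ 2), mul_div_mul_right _ _ h0]
    simp [rowNorms]

theorem sum_rowProb {τ n : ℕ} (A : Fin τ → Matrix (Fin n) (Fin n) ℂ) (hA : ∃ ℓ, A ℓ ≠ 0) :
    ∑ i, rowProb A i = 1 := by
  obtain ⟨ℓ, hℓ⟩ := hA
  have hpos : 0 < ∑ ℓ, ‖A ℓ‖ ^ 2 :=
    Finset.sum_pos' (fun _ _ => by positivity) ⟨ℓ, Finset.mem_univ ℓ, by positivity⟩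
  simp only [rowProb_eq]
  rw [← Finset.sum_div, Finset.sum_comm]
  simp only [← frob_sq]
  exact div_self hpos.ne'

theorem sum_condColProb {τ n : ℕ} (A : Fin τ → Matrix (Fin n) (Fin n) ℂ) (i : Fin n)
    (hi : rowProb A i ≠ 0) : ∑ j, condColProb A i j = 1 := by
  have h0 : ∑ ℓ, ‖rowVec (A ℓ) i‖ ^ 2 ≠ 0 := fun h => hi (by rw [rowProb_eq, h, zero_div])
  simp only [condColProb]
  rw [Finset.sum_comm, ← div_self h0, Finset.sum_div]
  refine Finset.sum_congr rfl fun k _ => ?_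
  rw [← Finset.sum_mul]
  by_cases hk : ‖rowVec (A k) i‖ ^ 2 = 0
  · simp [hk]
  · simp only [lengthSquared]
    rw [← Finset.sum_div, ← EuclideanSpace.norm_sq_eq, div_self hk, one_mul]

theorem sum_outcomeProb {τ n p : ℕ} (A : Fin τ → Matrix (Fin n) (Fin n) ℂ) (hA : ∃ ℓ, A ℓ ≠ 0)
    (hp : 0 < p) : ∑ ω : (Fin p → Fin n) × (Fin p → Fin n), outcomeProb A ω = 1 := by
  rw [Fintype.sum_prod_type]
  have key : ∀ i : Fin p → Fin n, ∑ j : Fin p → Fin n, outcomeProb A (i, j)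
      = ∏ s, rowProb A (i s) := by
    intro i
    simp only [outcomeProb]
    rw [← Finset.mul_sum]
    by_cases h : ∏ s, rowProb A (i s) = 0
    · simp [h]
    · have hi : ∀ s, rowProb A (i s) ≠ 0 := fun s => Finset.prod_ne_zero_iff.1 h s (by simp)
      have hc : ∑ j, colProb A i j = 1 := by
        simp only [colProb]
        rw [Finset.sum_comm]
        simp only [← Finset.mul_sum, sum_condColProb A _ (hi _)]
        simp; field_simp
      rw [← Fintype.prod_sum (f := fun (_ : Fin p) j => colProb A i j)]
      simp [hc]
  simp only [key]
  rw [← Fintype.prod_sum (f := fun (_ : Fin p) j => rowProb A j)]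
  simp [sum_rowProb A hA]

end WeightedSampling

end

/-! Write `Φ = ∑ ‖A_ℓ‖²`. By Cauchy–Schwarz, `‖A(i,·)‖² ≤ τ Φ P_i`, so `P` is a length-square law
for the rows of `A` up to the factor `τ`; likewise `P'` for the columns of `S`. Sampling `p` rows
from such a law makes the expected squared Frobenius error of the Gram matrix at most `(τΦ)²/p`
(`expected_gram_error`). Applied twice (`expected_gramError_le`), with Markov's inequality, this
makes both `D₁ = ‖S†S - A†A‖` and `D₂ = ‖SS† - WW†‖` small with probability at least 9/10.

The rest is deterministic and needs no spectral gap. With `U` the kept singular vectors and `d`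
their singular values, `V = S†U diag(1/d)`, so `V†V = diag(1/d) U†SS†U diag(1/d)`. Replacing `SS†`
by `WW†` gives the identity, so `‖V†V - 1‖ ≤ κ = D₂/g`, where `g = γΦ` is the threshold.

For `Π = VV†` and `N = 2Π - Π²`, `‖A(1-Π)‖² = ‖A‖² - tr(A†A N)`. Replacing `A†A` by `S†S`, and `SS†`
by `WW†`, turns the trace into the sum of the kept `σ²`, up to small errors
(`almost_isometry_of_eigenvectors`). Ky Fan's inequality shows that the top `rank A` values `σ²` add
up to almost `‖A‖²` (`norm_sq_le_sum_singular`), and discarding loses at most `g` for each of them.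
Hence `A(1-Π)` is small, and for Hermitian `A` this bounds `ΠAΠ - A` (`norm_conj_sub_le`).
`error_budget` inserts the constants. -/

noncomputable section

open scoped ComplexOrder

namespace WeightedSampling

/-! ### Frobenius norm and trace inequalities -/

section Frobenius

variable {l m n k : Type*} [Fintype l] [Fintype m] [Fintype n] [Fintype k]

theorem frobenius_sq_eq_sum (M : Matrix m n ℂ) : ‖M‖ ^ 2 = ∑ i, ∑ j, ‖M i j‖ ^ 2 := by
  rw [Matrix.frobenius_norm_def, ← Real.sqrt_eq_rpow, Real.sq_sqrt (by positivity)]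
  simp

theorem trace_conjTranspose_mul_self (M : Matrix m n ℂ) :
    (Mᴴ * M).trace = ((‖M‖ ^ 2 : ℝ) : ℂ) := by
  rw [frobenius_sq_eq_sum, Finset.sum_comm]
  simp [Matrix.trace, Matrix.mul_apply, Complex.conj_mul']

theorem norm_trace_mul_le (M : Matrix m n ℂ) (N : Matrix n m ℂ) :
    ‖(M * N).trace‖ ≤ ‖M‖ * ‖N‖ := by
  have h1 : ‖(M * N).trace‖ ≤ ∑ x : m × n, ‖M x.1 x.2‖ * ‖N x.2 x.1‖ := by
    rw [Fintype.sum_prod_type]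
    simp only [Matrix.trace, Matrix.mul_apply, Matrix.diag]
    refine (norm_sum_le _ _).trans (Finset.sum_le_sum fun i _ => ?_)
    refine (norm_sum_le _ _).trans (Finset.sum_le_sum fun j _ => ?_)
    rw [norm_mul]
  have h2 := Finset.sum_mul_sq_le_sq_mul_sq (Finset.univ : Finset (m × n))
    (fun x => ‖M x.1 x.2‖) (fun x => ‖N x.2 x.1‖)
  have h3 : ∑ x : m × n, ‖M x.1 x.2‖ ^ 2 = ‖M‖ ^ 2 := by
    rw [frobenius_sq_eq_sum, Fintype.sum_prod_type]
  have h4 : ∑ x : m × n, ‖N x.2 x.1‖ ^ 2 = ‖N‖ ^ 2 := by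
    rw [frobenius_sq_eq_sum, Fintype.sum_prod_type, Finset.sum_comm]
  rw [h3, h4, ← mul_pow] at h2
  exact h1.trans ((le_abs_self _).trans (abs_le_of_sq_le_sq h2 (by positivity)))

theorem abs_re_trace_mul_le (M : Matrix m n ℂ) (N : Matrix n m ℂ) :
    |(M * N).trace.re| ≤ ‖M‖ * ‖N‖ :=
  (Complex.abs_re_le_norm _).trans (norm_trace_mul_le M N)

/-- An isometry (here a matrix with orthonormal columns) does not increase the norm. -/
theorem norm_conjTranspose_mul_le [DecidableEq k] (U : Matrix m k ℂ) (hU : Uᴴ * U = 1)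
    (M : Matrix m n ℂ) : ‖Uᴴ * M‖ ≤ ‖M‖ := by
  have h1 : ‖Uᴴ * M‖ ^ 2 ≤ ‖M‖ * ‖U * (Uᴴ * M)‖ := by
    have := abs_re_trace_mul_le Mᴴ (U * (Uᴴ * M))
    rw [← Matrix.mul_assoc, show Mᴴ * U = (Uᴴ * M)ᴴ by simp, trace_conjTranspose_mul_self,
      Complex.ofReal_re, Matrix.frobenius_norm_conjTranspose] at this
    exact (le_abs_self _).trans this
  have h2 : ‖U * (Uᴴ * M)‖ ^ 2 = ‖Uᴴ * M‖ ^ 2 := by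
    have := trace_conjTranspose_mul_self (U * (Uᴴ * M))
    rw [Matrix.conjTranspose_mul, Matrix.mul_assoc, ← Matrix.mul_assoc Uᴴ U, hU, Matrix.one_mul,
      trace_conjTranspose_mul_self] at this
    exact_mod_cast this.symm
  have h3 : ‖U * (Uᴴ * M)‖ = ‖Uᴴ * M‖ := by
    rwa [sq_eq_sq₀ (norm_nonneg _) (norm_nonneg _)] at h2
  rw [h3] at h1
  by_contra! h
  nlinarith [norm_nonneg M, norm_nonneg (Uᴴ * M)]

theorem norm_mul_isometry_le [DecidableEq k] (U : Matrix m k ℂ) (hU : Uᴴ * U = 1)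
    (M : Matrix n m ℂ) : ‖M * U‖ ≤ ‖M‖ := by
  have := norm_conjTranspose_mul_le U hU Mᴴ
  rwa [← Matrix.conjTranspose_mul, Matrix.frobenius_norm_conjTranspose,
    Matrix.frobenius_norm_conjTranspose] at this

theorem norm_diagonal_mul_le [DecidableEq m] (v : m → ℂ) (M : Matrix m n ℂ) {c : ℝ}
    (hc : 0 ≤ c) (hv : ∀ i, ‖v i‖ ≤ c) : ‖Matrix.diagonal v * M‖ ≤ c * ‖M‖ := by
  refine (pow_le_pow_iff_left₀ (norm_nonneg _) (by positivity) two_ne_zero).1 ?_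
  rw [mul_pow, frobenius_sq_eq_sum, frobenius_sq_eq_sum, Finset.mul_sum]
  refine Finset.sum_le_sum fun i _ => ?_
  rw [Finset.mul_sum]
  refine Finset.sum_le_sum fun j _ => ?_
  rw [Matrix.diagonal_mul, norm_mul, mul_pow]
  gcongr
  exact hv i

theorem norm_mul_diagonal_le [DecidableEq n] (v : n → ℂ) (M : Matrix m n ℂ) {c : ℝ}
    (hc : 0 ≤ c) (hv : ∀ i, ‖v i‖ ≤ c) : ‖M * Matrix.diagonal v‖ ≤ c * ‖M‖ := by
  have := norm_diagonal_mul_le (star v) Mᴴ hc (by simpa using hv)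
  rwa [← Matrix.diagonal_conjTranspose, ← Matrix.conjTranspose_mul,
    Matrix.frobenius_norm_conjTranspose, Matrix.frobenius_norm_conjTranspose] at this

theorem norm_sq_one [DecidableEq m] : ‖(1 : Matrix m m ℂ)‖ ^ 2 = Fintype.card m := by
  have := trace_conjTranspose_mul_self (1 : Matrix m m ℂ)
  simp only [Matrix.conjTranspose_one, Matrix.mul_one, Matrix.trace_one] at this
  exact_mod_cast this.symm

theorem norm_one_eq [DecidableEq m] : ‖(1 : Matrix m m ℂ)‖ = √(Fintype.card m) := by
  rw [← norm_sq_one, Real.sqrt_sq (norm_nonneg _)]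

/-- If `Vᴴ * V` is within `κ` of the identity, then `V * Vᴴ` has norm at most `1 + κ`. -/
theorem norm_mul_conjTranspose_mul_le [DecidableEq k] (V : Matrix m k ℂ) {κ : ℝ}
    (hV : ‖Vᴴ * V - 1‖ ≤ κ) (M : Matrix m n ℂ) : ‖V * Vᴴ * M‖ ≤ (1 + κ) * ‖M‖ := by
  have hκ : 0 ≤ κ := (norm_nonneg _).trans hV
  have h1 : ‖Vᴴ * M‖ ^ 2 ≤ ‖M‖ * ‖V * Vᴴ * M‖ := by
    have := abs_re_trace_mul_le Mᴴ (V * Vᴴ * M)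
    rw [Matrix.mul_assoc V, ← Matrix.mul_assoc, show Mᴴ * V = (Vᴴ * M)ᴴ by simp,
      trace_conjTranspose_mul_self, Complex.ofReal_re, Matrix.frobenius_norm_conjTranspose] at this
    rw [Matrix.mul_assoc V]
    exact (le_abs_self _).trans this
  -- The left side is the quadratic form of `Vᴴ * V = 1 + (Vᴴ * V - 1)` at `Vᴴ * M`.
  have h2 : ‖V * Vᴴ * M‖ ^ 2 ≤ (1 + κ) * ‖Vᴴ * M‖ ^ 2 := by
    have e : (V * Vᴴ * M)ᴴ * (V * Vᴴ * M)
        = (Vᴴ * M)ᴴ * (Vᴴ * M) + (Vᴴ * M)ᴴ * ((Vᴴ * V - 1) * (Vᴴ * M)) := by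
      simp only [Matrix.conjTranspose_mul, Matrix.conjTranspose_conjTranspose, Matrix.mul_assoc,
        Matrix.sub_mul, Matrix.mul_sub, Matrix.one_mul]
      abel
    have e2 := congrArg (fun z => (Matrix.trace z).re) e
    simp only [trace_conjTranspose_mul_self, Matrix.trace_add, Complex.add_re,
      Complex.ofReal_re] at e2
    have b := (le_abs_self _).trans
      (abs_re_trace_mul_le (Vᴴ * M)ᴴ ((Vᴴ * V - 1) * (Vᴴ * M)))
    have b2 := Matrix.frobenius_norm_mul (Vᴴ * V - 1) (Vᴴ * M)
    rw [Matrix.frobenius_norm_conjTranspose] at b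
    have b3 : ‖Vᴴ * M‖ * ‖(Vᴴ * V - 1) * (Vᴴ * M)‖ ≤ ‖Vᴴ * M‖ * (κ * ‖Vᴴ * M‖) := by
      gcongr
      exact b2.trans (by gcongr)
    rw [e2]
    nlinarith
  rcases (norm_nonneg (V * Vᴴ * M)).eq_or_lt with h | h
  · rw [← h]; positivity
  · refine le_of_mul_le_mul_right ?_ h
    calc _ = ‖V * Vᴴ * M‖ ^ 2 := (sq _).symm
      _ ≤ (1 + κ) * (‖M‖ * ‖V * Vᴴ * M‖) := h2.trans (by gcongr)
      _ = _ := by ring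

end Frobenius

/-! ### Orthogonal projections -/

section Projection

variable {m n : Type*} [Fintype m] [Fintype n]

/-- The orthogonal projection onto the column space of a matrix. -/
theorem exists_projection (M : Matrix m n ℂ) :
    ∃ H : Matrix m m ℂ, Hᴴ = H ∧ H * H = H ∧ H * M = M ∧ H.rank ≤ M.rank ∧
      H.trace = (M.rank : ℂ) := by
  classical
  have hM : (M * Mᴴ).IsHermitian := Matrix.isHermitian_mul_conjTranspose_self M
  set U : Matrix m m ℂ := (hM.eigenvectorUnitary : Matrix m m ℂ) with hU
  have hUU : Uᴴ * U = 1 := Matrix.mem_unitaryGroup_iff'.1 hM.eigenvectorUnitary.2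
  set v : m → ℂ := fun i => (hM.eigenvalues i : ℂ) with hv
  have hspec : M * Mᴴ = U * Matrix.diagonal v * Uᴴ := by
    have := hM.spectral_theorem
    rw [Unitary.conjStarAlgAut_apply] at this
    exact this
  -- The projection is the spectral projection of `M * Mᴴ` for its nonzero eigenvalues.
  set w : m → ℂ := fun i => if hM.eigenvalues i = 0 then 0 else 1 with hw
  have hwv : ∀ i, w i * v i = v i := by
    intro i
    simp only [hw, hv]
    split_ifs with h <;> simp [h]
  have hww : ∀ i, w i * w i = w i := by
    intro i
    simp only [hw]
    split_ifs with h <;> simp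
  have hH : (U * Matrix.diagonal w * Uᴴ)ᴴ = U * Matrix.diagonal w * Uᴴ := by
    rw [Matrix.conjTranspose_mul, Matrix.conjTranspose_mul, Matrix.conjTranspose_conjTranspose,
      Matrix.diagonal_conjTranspose, Matrix.mul_assoc]
    congr 3
    ext i
    simp only [hw, Pi.star_apply]
    split_ifs <;> simp
  have key : ∀ a b : m → ℂ, U * Matrix.diagonal a * Uᴴ * (U * Matrix.diagonal b * Uᴴ)
      = U * Matrix.diagonal (fun i => a i * b i) * Uᴴ := by
    intro a b
    rw [← Matrix.diagonal_mul_diagonal]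
    calc _ = U * Matrix.diagonal a * (Uᴴ * U) * Matrix.diagonal b * Uᴴ := by
          simp only [Matrix.mul_assoc]
      _ = _ := by rw [hUU]; simp only [Matrix.mul_assoc, Matrix.mul_one]
  refine ⟨U * Matrix.diagonal w * Uᴴ, hH, ?_, ?_, ?_, ?_⟩
  · rw [key]
    simp only [hww]
  · have h0 : (U * Matrix.diagonal w * Uᴴ * M - M) * (U * Matrix.diagonal w * Uᴴ * M - M)ᴴ = 0 := by
      have e : U * Matrix.diagonal w * Uᴴ * (M * Mᴴ) = M * Mᴴ := by
        rw [hspec, key]; simp only [hwv]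
      set H := U * Matrix.diagonal w * Uᴴ
      calc _ = (H * (M * Mᴴ) - M * Mᴴ) * Hᴴ - (H * (M * Mᴴ) - M * Mᴴ) := by
            simp only [Matrix.conjTranspose_sub, Matrix.conjTranspose_mul, Matrix.mul_sub,
              Matrix.sub_mul, Matrix.mul_assoc]
        _ = 0 := by rw [e]; simp
    exact sub_eq_zero.1 (Matrix.self_mul_conjTranspose_eq_zero.1 h0)
  -- With `0⁻¹ = 0`, `w i = v i * (v i)⁻¹` holds for the zero eigenvalues too, so the projection
  -- factors through `M`.
  · have e : U * Matrix.diagonal w * Uᴴ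
        = M * (Mᴴ * (U * Matrix.diagonal (fun i => (v i)⁻¹) * Uᴴ)) := by
      rw [← Matrix.mul_assoc, hspec, key]
      congr 3
      ext i
      simp only [hw, hv]
      split_ifs with h <;> simp [h]
    rw [e]
    exact Matrix.rank_mul_le_left _ _
  · rw [Matrix.trace_mul_comm, ← Matrix.mul_assoc, hUU, Matrix.one_mul, Matrix.trace_diagonal,
      ← Matrix.rank_self_mul_conjTranspose, hM.rank_eq_card_non_zero_eigs]
    simp only [hw, Fintype.card_subtype]
    rw [Finset.card_filter, Nat.cast_sum]
    exact Finset.sum_congr rfl fun i _ => by by_cases h : hM.eigenvalues i = 0 <;> simp [h]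

theorem norm_sq_of_projection {H : Matrix m m ℂ} (h1 : Hᴴ = H) (h2 : H * H = H) :
    ‖H‖ ^ 2 = H.trace.re := by
  have := trace_conjTranspose_mul_self H
  rw [h1, h2] at this
  rw [this, Complex.ofReal_re]

theorem norm_projection_mul_le {H : Matrix m m ℂ} (h1 : Hᴴ = H) (h2 : H * H = H)
    (M : Matrix m n ℂ) : ‖H * M‖ ≤ ‖M‖ := by
  have h := trace_conjTranspose_mul_self (H * M)
  rw [Matrix.conjTranspose_mul, h1, Matrix.mul_assoc, ← Matrix.mul_assoc H, h2] at h
  have h' := abs_re_trace_mul_le Mᴴ (H * M)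
  rw [h, Complex.ofReal_re, Matrix.frobenius_norm_conjTranspose] at h'
  have h3 := (le_abs_self _).trans h'
  by_contra! hc
  nlinarith [norm_nonneg M, norm_nonneg (H * M)]

end Projection

/-! ### Ky Fan's inequality and the energy of the top singular values -/

/-- The maximum of a linear functional with antitone coefficients over
`{0 ≤ h ≤ 1, ∑ h ≤ R}`. -/
theorem sum_mul_le_sum_lt {p R : ℕ} (s h : Fin p → ℝ) (hs : Antitone s) (hs0 : ∀ k, 0 ≤ s k)
    (h0 : ∀ k, 0 ≤ h k) (h1 : ∀ k, h k ≤ 1) (hR : ∑ k, h k ≤ R) :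
    ∑ k, s k * h k ≤ ∑ k with k.val < R, s k := by
  rw [Finset.sum_filter]
  rcases lt_or_ge R p with hlt | hge
  -- After subtracting the cut-off value `c`, the inequality holds term by term; the constraint on
  -- `∑ h` pays for the subtraction.
  · set c := s ⟨R, hlt⟩ with hc
    have hcard : ∑ k : Fin p, (if k.val < R then (1 : ℝ) else 0) = R := by
      rw [← Finset.sum_filter, Finset.sum_const, nsmul_one]
      have : (Finset.univ.filter fun k : Fin p => k.val < R) = Finset.Iio ⟨R, hlt⟩ := by
        ext k; simp [Fin.lt_def]
      rw [this, Fin.card_Iio]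
    have h2 : ∑ k, (s k - c) * h k ≤ ∑ k : Fin p, (if k.val < R then s k - c else 0) := by
      refine Finset.sum_le_sum fun k _ => ?_
      split_ifs with hk
      · have : c ≤ s k := hs (by simp [Fin.le_def]; omega)
        nlinarith [h1 k]
      · have : s k ≤ c := hs (by simp [Fin.le_def]; omega)
        nlinarith [h0 k]
    have h3 : ∑ k : Fin p, (if k.val < R then s k - c else 0)
        = ∑ k : Fin p, (if k.val < R then s k else 0) - c * R := by
      rw [← hcard, Finset.mul_sum, ← Finset.sum_sub_distrib]
      exact Finset.sum_congr rfl fun k _ => by split_ifs <;> simp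
    have h4 : ∑ k, (s k - c) * h k = ∑ k, s k * h k - c * ∑ k, h k := by
      rw [Finset.mul_sum, ← Finset.sum_sub_distrib]
      exact Finset.sum_congr rfl fun k _ => by ring
    have h5 : c * ∑ k, h k ≤ c * R := mul_le_mul_of_nonneg_left hR (hs0 _)
    linarith
  · refine Finset.sum_le_sum fun k _ => ?_
    rw [if_pos (k.2.trans_le hge)]
    exact mul_le_of_le_one_right (hs0 k) (h1 k)

/-- Ky Fan's inequality for an orthogonal projection of rank at most `R`. -/
theorem re_trace_projection_mul_le {p R : ℕ} {W X Y : Matrix (Fin p) (Fin p) ℂ} {σ : Fin p → ℝ}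
    (hW : IsSVD W X Y σ) {H : Matrix (Fin p) (Fin p) ℂ} (h1 : Hᴴ = H) (h2 : H * H = H)
    (hR : H.trace.re ≤ R) :
    (H * (W * Wᴴ)).trace.re ≤ ∑ k with k.val < R, σ k ^ 2 := by
  have hX : Xᴴ * X = 1 := Matrix.mem_unitaryGroup_iff'.1 hW.left_unitary
  have hX' : X * Xᴴ = 1 := Matrix.mem_unitaryGroup_iff.1 hW.left_unitary
  have hY : Yᴴ * Y = 1 := Matrix.mem_unitaryGroup_iff'.1 hW.right_unitary
  set D : Matrix (Fin p) (Fin p) ℂ := Matrix.diagonal fun k => (σ k : ℂ) with hD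
  have hDD : D * Dᴴ = Matrix.diagonal fun k => ((σ k ^ 2 : ℝ) : ℂ) := by
    rw [hD, Matrix.diagonal_conjTranspose, Matrix.diagonal_mul_diagonal]
    congr 1; ext k; simp [sq]
  have hB : W * Wᴴ = X * (D * Dᴴ) * Xᴴ := by
    rw [hW.eq_mul, ← hD, Matrix.conjTranspose_mul, Matrix.conjTranspose_mul,
      Matrix.conjTranspose_conjTranspose]
    calc _ = X * D * (Yᴴ * Y) * Dᴴ * Xᴴ := by simp only [Matrix.mul_assoc]
      _ = _ := by rw [hY]; simp only [Matrix.mul_assoc, Matrix.one_mul]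
  set C := Xᴴ * H * X with hC
  have hCC : Cᴴ * C = C := by
    simp only [hC, Matrix.conjTranspose_mul, Matrix.conjTranspose_conjTranspose, h1]
    calc _ = Xᴴ * H * (X * Xᴴ) * H * X := by simp only [Matrix.mul_assoc]
      _ = Xᴴ * (H * H) * X := by rw [hX']; simp only [Matrix.mul_assoc, Matrix.one_mul]
      _ = _ := by rw [h2]
  -- As `C` is a projection, its diagonal entries are squared column norms, which places them in
  -- `[0, 1]`.
  have hdiag : ∀ k, ((C k k).re = ∑ j, ‖C j k‖ ^ 2) := by
    intro k
    conv_lhs => rw [← hCC]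
    simp [Matrix.mul_apply, Complex.conj_mul', ← Complex.ofReal_pow]
  have ht : (H * (W * Wᴴ)).trace.re = ∑ k, σ k ^ 2 * (C k k).re := by
    have : (H * (W * Wᴴ)).trace = ((D * Dᴴ) * C).trace := by
      rw [hB, hC, ← Matrix.mul_assoc, Matrix.trace_mul_comm, ← Matrix.mul_assoc,
        ← Matrix.mul_assoc, Matrix.trace_mul_comm, Matrix.mul_assoc]
    rw [this, hDD]
    simp [Matrix.trace, Matrix.diagonal_mul, -Complex.ofReal_pow]
  rw [ht]
  refine sum_mul_le_sum_lt (fun k => σ k ^ 2) (fun k => (C k k).re) ?_ (fun k => sq_nonneg _)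
    (fun k => ?_) (fun k => ?_) ?_
  · intro a b hab
    exact pow_le_pow_left₀ (hW.nonneg b) (hW.antitone hab) 2
  · rw [hdiag]; positivity
  · have : ‖C k k‖ ^ 2 ≤ ∑ j, ‖C j k‖ ^ 2 :=
      Finset.single_le_sum (f := fun j => ‖C j k‖ ^ 2) (fun _ _ => by positivity)
        (Finset.mem_univ k)
    rw [← hdiag] at this
    have h4 := Complex.re_le_norm (C k k)
    by_contra! hc
    nlinarith
  · have : C.trace = H.trace := by
      rw [hC, Matrix.trace_mul_comm, ← Matrix.mul_assoc, hX', Matrix.one_mul]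
    rw [← this] at hR
    simpa [Matrix.trace] using hR

/-- The top `rank A` singular values of `W` capture the norm of `A`, up to the two approximation
errors. -/
theorem norm_sq_le_sum_singular {n p : ℕ} (A : Matrix (Fin n) (Fin n) ℂ)
    (S : Matrix (Fin p) (Fin n) ℂ) {W X Y : Matrix (Fin p) (Fin p) ℂ} {σ : Fin p → ℝ}
    (hW : IsSVD W X Y σ) :
    ‖A‖ ^ 2 ≤ ∑ k with k.val < A.rank, σ k ^ 2
      + √A.rank * (‖Sᴴ * S - Aᴴ * A‖ + ‖S * Sᴴ - W * Wᴴ‖) := by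
  obtain ⟨P, hP1, hP2, hP3, hP4, hP5⟩ := exists_projection Aᴴ
  rw [Matrix.rank_conjTranspose] at hP4 hP5
  have hAP : A * P = A := by
    have := congrArg Matrix.conjTranspose hP3
    rwa [Matrix.conjTranspose_mul, Matrix.conjTranspose_conjTranspose, hP1] at this
  -- The chain is `‖A‖² = tr(A†A P) ≈ tr(S†S P) = ‖HSP‖² ≤ ‖HS‖² = tr(H SS†) ≈ tr(H WW†)`. Both
  -- projections have rank at most `rank A`, so each replacement costs `√rank A` times a Gram error.
  obtain ⟨H, hH1, hH2, hH3, -, hH5⟩ := exists_projection (S * P)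
  have hrk : (S * P).rank ≤ A.rank := (Matrix.rank_mul_le_right S P).trans hP4
  have hPn : ‖P‖ ≤ √A.rank := by
    refine Real.le_sqrt_of_sq_le ?_
    rw [norm_sq_of_projection hP1 hP2, hP5]; simp
  have hHt : H.trace.re ≤ A.rank := by rw [hH5]; simpa using hrk
  have hHn : ‖H‖ ≤ √A.rank := by
    refine Real.le_sqrt_of_sq_le ?_
    rwa [norm_sq_of_projection hH1 hH2]
  have e1 : ‖A‖ ^ 2 = ((Sᴴ * S) * P).trace.re - ((Sᴴ * S - Aᴴ * A) * P).trace.re := by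
    have := trace_conjTranspose_mul_self A
    conv_lhs at this => rw [← hAP, Matrix.conjTranspose_mul, hP1, Matrix.mul_assoc,
      Matrix.trace_mul_comm, ← Matrix.mul_assoc, Matrix.mul_assoc _ P P, hP2]
    rw [Matrix.sub_mul, Matrix.trace_sub, Complex.sub_re, sub_sub_cancel, this, Complex.ofReal_re]
  have e2 : ((Sᴴ * S) * P).trace.re = ‖S * P‖ ^ 2 := by
    have := trace_conjTranspose_mul_self (S * P)
    rw [Matrix.conjTranspose_mul, hP1, Matrix.trace_mul_comm, Matrix.mul_assoc,
      ← Matrix.mul_assoc P P, hP2, Matrix.trace_mul_comm, Matrix.mul_assoc,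
      Matrix.trace_mul_comm] at this
    rw [this, Complex.ofReal_re]
  have e3 : ‖S * P‖ ≤ ‖H * S‖ := by
    rw [← hH3, ← Matrix.mul_assoc]
    have := norm_projection_mul_le hP1 hP2 (H * S)ᴴ
    rwa [← Matrix.frobenius_norm_conjTranspose, Matrix.conjTranspose_mul,
      Matrix.conjTranspose_conjTranspose, hP1, Matrix.frobenius_norm_conjTranspose (H * S)] at this
  have e4 : ‖H * S‖ ^ 2 = (H * (W * Wᴴ)).trace.re + (H * (S * Sᴴ - W * Wᴴ)).trace.re := by
    have := trace_conjTranspose_mul_self (H * S)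
    rw [Matrix.conjTranspose_mul, hH1, Matrix.mul_assoc, ← Matrix.mul_assoc H H, hH2,
      Matrix.trace_mul_comm, Matrix.mul_assoc] at this
    rw [Matrix.mul_sub, Matrix.trace_sub, Complex.sub_re, add_sub_cancel, this, Complex.ofReal_re]
  have e5 := re_trace_projection_mul_le hW hH1 hH2 hHt
  have e6 := (neg_le_abs _).trans (abs_re_trace_mul_le (Sᴴ * S - Aᴴ * A) P)
  have e7 := (le_abs_self _).trans (abs_re_trace_mul_le H (S * Sᴴ - W * Wᴴ))
  have e8 : ‖Sᴴ * S - Aᴴ * A‖ * ‖P‖ ≤ ‖Sᴴ * S - Aᴴ * A‖ * √A.rank := by gcongr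
  have e9 : ‖H‖ * ‖S * Sᴴ - W * Wᴴ‖ ≤ √A.rank * ‖S * Sᴴ - W * Wᴴ‖ := by gcongr
  have e10 : ‖S * P‖ ^ 2 ≤ ‖H * S‖ ^ 2 := pow_le_pow_left₀ (norm_nonneg _) e3 2
  linarith

/-! ### Reconstruction from approximate singular vectors -/

section Reconstruction

variable {m n k : Type*} [Fintype m] [Fintype n] [Fintype k]

/-- `V * Vᴴ` and `G = Vᴴ * V` share their nonzero eigenvalues, and `x(2 - x) = 1 - (1 - x)²`, so the
error is only quadratic in `κ`. -/
theorem norm_two_mul_sub_sq_le [DecidableEq k] (V : Matrix n k ℂ) {κ : ℝ} (hV : ‖Vᴴ * V - 1‖ ≤ κ) :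
    ‖(2 : ℂ) • (V * Vᴴ) - V * Vᴴ * (V * Vᴴ)‖ ≤ √(Fintype.card k) + κ ^ 2 := by
  set G := Vᴴ * V with hG
  have hGH : Gᴴ = G := by simp [hG]
  set N := (2 : ℂ) • (V * Vᴴ) - V * Vᴴ * (V * Vᴴ) with hN
  set C : Matrix k k ℂ := (2 : ℂ) • 1 - G with hC
  have hCH : Cᴴ = C := by simp [hC, hGH]
  have hNV : N = V * C * Vᴴ := by
    simp only [hN, hC, hG, Matrix.mul_sub, Matrix.sub_mul, Matrix.mul_assoc, Matrix.mul_smul,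
      Matrix.smul_mul, Matrix.one_mul]
  have hQ : G * C = 1 - (G - 1) * (G - 1) := by
    simp only [hC, two_smul]; noncomm_ring
  have hQ' : C * G = 1 - (G - 1) * (G - 1) := by
    simp only [hC, two_smul]; noncomm_ring
  have h1 : ‖N‖ ^ 2 = ‖G * C‖ ^ 2 := by
    have a := trace_conjTranspose_mul_self N
    have b := trace_conjTranspose_mul_self (G * C)
    have : (Nᴴ * N).trace = ((G * C)ᴴ * (G * C)).trace := by
      calc (Nᴴ * N).trace = (V * (C * G * C * Vᴴ)).trace := by
            rw [hNV]
            simp only [Matrix.conjTranspose_mul, Matrix.conjTranspose_conjTranspose, hCH, hG,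
              Matrix.mul_assoc]
        _ = ((C * G) * (C * G)).trace := by
            rw [Matrix.trace_mul_comm]
            simp only [hG, Matrix.mul_assoc]
        _ = _ := by
            rw [Matrix.conjTranspose_mul, hCH, hGH, hQ, ← hQ']
    rw [this, b] at a
    exact_mod_cast a.symm
  have h2 : ‖N‖ = ‖G * C‖ := by
    rwa [sq_eq_sq₀ (norm_nonneg _) (norm_nonneg _)] at h1
  rw [h2, hQ]
  refine (norm_sub_le _ _).trans ?_
  rw [norm_one_eq]
  gcongr
  refine (Matrix.frobenius_norm_mul _ _).trans ?_
  rw [← sq]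
  gcongr

/-- If `U` has orthonormal columns which are eigenvectors of `B` for the eigenvalues `d k ^ 2`,
then `V = Sᴴ * U * diag(1 / d)`, for `S * Sᴴ` close to `B`, has almost orthonormal columns, which
span a space on which `S` has almost the norm that `B` predicts. -/
theorem almost_isometry_of_eigenvectors [DecidableEq k] {S : Matrix m n ℂ}
    {B : Matrix m m ℂ} (hB : Bᴴ = B) {U : Matrix m k ℂ} (hU : Uᴴ * U = 1)
    {d : k → ℝ} {g : ℝ} (hg : 0 < g) (hd0 : ∀ k, 0 ≤ d k)
    (hd : ∀ k, g ≤ d k ^ 2) (hBU : B * U = U * Matrix.diagonal fun k => ((d k : ℂ) ^ 2))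
    {V : Matrix n k ℂ} (hV : V = Sᴴ * (U * Matrix.diagonal fun k => ((d k : ℂ)⁻¹))) :
    ‖Vᴴ * V - 1‖ ≤ ‖S * Sᴴ - B‖ / g ∧
    ∑ k, d k ^ 2 - ‖S * Sᴴ - B‖ * (√(Fintype.card k) + 2 * (‖S * Sᴴ - B‖ / g)
        + (‖S * Sᴴ - B‖ / g) ^ 2)
      ≤ (Sᴴ * S * ((2 : ℂ) • (V * Vᴴ) - V * Vᴴ * (V * Vᴴ))).trace.re := by
  set E := S * Sᴴ - B with hE
  have hEH : Eᴴ = E := by simp [hE, hB]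
  have hT : S * Sᴴ = B + E := by simp [hE]
  set D : Matrix k k ℂ := Matrix.diagonal fun k => ((d k : ℂ)⁻¹) with hD
  have hDH : Dᴴ = D := by
    rw [hD, Matrix.diagonal_conjTranspose]; congr 1; ext i; simp
  have hdpos : ∀ i, 0 < d i := fun i => by
    refine (hd0 i).lt_of_ne fun h => ?_
    have := hd i
    rw [← h] at this
    norm_num at this
    linarith
  have hDle : ∀ i, ‖((d i : ℂ)⁻¹)‖ ≤ (√g)⁻¹ := by
    intro i
    rw [norm_inv, Complex.norm_real, Real.norm_of_nonneg (hd0 i)]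
    exact inv_anti₀ (Real.sqrt_pos.2 hg) (Real.sqrt_le_iff.2 ⟨hd0 i, hd i⟩)
  have hsq : ∀ x : ℝ, (√g)⁻¹ * ((√g)⁻¹ * x) = x / g := by
    intro x
    rw [← mul_assoc, ← mul_inv, Real.mul_self_sqrt hg.le]
    field_simp
  set Δ : Matrix k k ℂ := Matrix.diagonal fun k => ((d k : ℂ) ^ 2) with hΔ
  have hΔD : Δ * D * D = 1 := by
    simp only [hΔ, hD, Matrix.diagonal_mul_diagonal]
    rw [← Matrix.diagonal_one]
    congr 1; ext i
    have : (d i : ℂ) ≠ 0 := by exact_mod_cast (hdpos i).ne'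
    field_simp
  have hDΔ : D * Δ = Δ * D := by
    simp only [hΔ, hD, Matrix.diagonal_mul_diagonal, mul_comm]
  set Y := U * D with hY
  have hYE : ‖Yᴴ * E‖ ≤ (√g)⁻¹ * ‖E‖ := by
    rw [hY, Matrix.conjTranspose_mul, hDH, Matrix.mul_assoc]
    refine (norm_diagonal_mul_le _ _ (by positivity) hDle).trans ?_
    gcongr
    exact norm_conjTranspose_mul_le U hU E
  have hEY : ‖E * Y‖ ≤ (√g)⁻¹ * ‖E‖ := by
    rw [← Matrix.frobenius_norm_conjTranspose, Matrix.conjTranspose_mul, hEH]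
    exact hYE
  have hYEY : ‖Yᴴ * E * Y‖ ≤ ‖E‖ / g := by
    rw [hY, ← Matrix.mul_assoc, ← hsq]
    refine (norm_mul_diagonal_le _ _ (by positivity) hDle).trans ?_
    gcongr
    exact (norm_mul_isometry_le U hU _).trans hYE
  have hYEU : ‖Yᴴ * E * U‖ ≤ (√g)⁻¹ * ‖E‖ := (norm_mul_isometry_le U hU _).trans hYE
  have hUEU : ‖Uᴴ * E * U‖ ≤ ‖E‖ :=
    (norm_mul_isometry_le U hU _).trans (norm_conjTranspose_mul_le U hU E)
  have hBY : B * Y = U * Δ * D := by rw [hY, ← Matrix.mul_assoc, hBU]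
  have hYBY : Yᴴ * B * Y = 1 := by
    rw [Matrix.mul_assoc, hBY, hY, Matrix.conjTranspose_mul, hDH, ← hΔD]
    calc _ = D * (Uᴴ * U) * Δ * D := by simp only [Matrix.mul_assoc]
      _ = _ := by rw [hU, Matrix.mul_one, hDΔ]
  have hG : Vᴴ * V - 1 = Yᴴ * E * Y := by
    rw [hV, ← hYBY, Matrix.conjTranspose_mul, Matrix.conjTranspose_conjTranspose]
    calc _ = Yᴴ * (S * Sᴴ) * Y - Yᴴ * B * Y := by simp only [Matrix.mul_assoc]
      _ = _ := by rw [hT, Matrix.mul_add, Matrix.add_mul, add_sub_cancel_left]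
  refine ⟨hG ▸ hYEY, ?_⟩
  -- `Z` is the inverse of `B` on the span of `U`, and `P` is the projection onto that span. The
  -- products `B * Z` and `Z * B` therefore collapse to `P`, which makes the expansion in powers of
  -- `E` finite and explicit.
  set Z := Y * Yᴴ with hZ
  set P := U * Uᴴ with hP
  have hPH : Pᴴ = P := by simp [hP]
  have hZH : Zᴴ = Z := by simp [hZ]
  have hPP : P * P = P := by
    calc P * P = U * (Uᴴ * U) * Uᴴ := by simp only [hP, Matrix.mul_assoc]
      _ = P := by rw [hU, Matrix.mul_one]
  have hPZ : P * Z = Z := by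
    calc P * Z = U * (Uᴴ * U) * D * Yᴴ := by simp only [hP, hZ, hY, Matrix.mul_assoc]
      _ = Z := by rw [hU, Matrix.mul_one]
  have hZP : Z * P = Z := by
    have := congrArg Matrix.conjTranspose hPZ
    rwa [Matrix.conjTranspose_mul, hPH, hZH] at this
  have hBZ : B * Z = P := by
    rw [hZ, ← Matrix.mul_assoc, hBY, hY, Matrix.conjTranspose_mul, hDH]
    calc _ = U * (Δ * D * D) * Uᴴ := by simp only [Matrix.mul_assoc]
      _ = P := by rw [hΔD, Matrix.mul_one]
  have hZB : Z * B = P := by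
    have := congrArg Matrix.conjTranspose hBZ
    rwa [Matrix.conjTranspose_mul, hPH, hZH, hB] at this
  have hTZ : (B + E) * Z = P + E * Z := by rw [Matrix.add_mul, hBZ]
  have hTZT : (B + E) * Z * (B + E) = P * B + P * E + E * P + E * Z * E := by
    rw [hTZ, Matrix.add_mul, Matrix.mul_add, Matrix.mul_add, Matrix.mul_assoc E Z B, hZB]
    abel
  have hTZTZT : (B + E) * Z * ((B + E) * Z * (B + E)) = P * B + P * E + P * E * P + P * E * Z * E
      + E * P + E * Z * E + E * Z * E * P + E * Z * E * Z * E := by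
    rw [hTZT, hTZ]
    have a1 : P * (P * B) = P * B := by rw [← Matrix.mul_assoc, hPP]
    have a2 : P * (P * E) = P * E := by rw [← Matrix.mul_assoc, hPP]
    have a3 : Z * (P * B) = P := by rw [← Matrix.mul_assoc, hZP, hZB]
    have a4 : Z * (P * E) = Z * E := by rw [← Matrix.mul_assoc, hZP]
    simp only [Matrix.add_mul, Matrix.mul_add, Matrix.mul_assoc, a1, a2, a3, a4]
    abel
  have hN : (Sᴴ * S * ((2 : ℂ) • (V * Vᴴ) - V * Vᴴ * (V * Vᴴ))).trace
      = 2 * ((B + E) * Z * (B + E)).trace - ((B + E) * Z * ((B + E) * Z * (B + E))).trace := by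
    have b1 : V * Vᴴ = Sᴴ * (Z * S) := by
      rw [hV, Matrix.conjTranspose_mul, Matrix.conjTranspose_conjTranspose, hZ]
      simp only [Matrix.mul_assoc]
    have b2 : (Sᴴ * S * (V * Vᴴ)).trace = ((B + E) * Z * (B + E)).trace := by
      rw [b1, ← hT, Matrix.mul_assoc, Matrix.trace_mul_comm]
      simp only [Matrix.mul_assoc]
    have b3 : (Sᴴ * S * (V * Vᴴ * (V * Vᴴ))).trace
        = ((B + E) * Z * ((B + E) * Z * (B + E))).trace := by
      rw [b1, ← hT, Matrix.mul_assoc, Matrix.trace_mul_comm]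
      simp only [Matrix.mul_assoc]
    rw [Matrix.mul_sub, Matrix.mul_smul, Matrix.trace_sub, Matrix.trace_smul, b2, b3, smul_eq_mul]
  have t1 : (E * P).trace = (P * E).trace := Matrix.trace_mul_comm _ _
  have t2 : (P * E * P).trace = (P * E).trace := by
    rw [Matrix.trace_mul_comm, ← Matrix.mul_assoc, hPP]
  have t3 : (E * Z * E * P).trace = (P * E * Z * E).trace := by
    rw [Matrix.trace_mul_comm]; simp only [Matrix.mul_assoc]
  have hN' : (Sᴴ * S * ((2 : ℂ) • (V * Vᴴ) - V * Vᴴ * (V * Vᴴ))).trace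
      = (P * B).trace + (P * E).trace + (E * Z * E).trace - 2 * (P * E * Z * E).trace
        - (E * Z * E * Z * E).trace := by
    rw [hN, hTZTZT, hTZT]
    simp only [Matrix.trace_add, t1, t2, t3]
    ring
  have u1 : (P * B).trace = ((∑ i, d i ^ 2 : ℝ) : ℂ) := by
    rw [Matrix.trace_mul_comm, hP, ← Matrix.mul_assoc, hBU, Matrix.trace_mul_comm,
      ← Matrix.mul_assoc, hU, Matrix.one_mul, Matrix.trace_diagonal]
    push_cast; rfl
  have u2 : |(P * E).trace.re| ≤ √(Fintype.card k) * ‖E‖ := by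
    have : (P * E).trace = (1 * (Uᴴ * E * U)).trace := by
      rw [hP, Matrix.mul_assoc, Matrix.trace_mul_comm, Matrix.one_mul]
    rw [this, ← norm_one_eq]
    exact (abs_re_trace_mul_le _ _).trans (by gcongr)
  -- This term has a favourable sign and is dropped.
  have u3 : 0 ≤ (E * Z * E).trace.re := by
    have := trace_conjTranspose_mul_self (Yᴴ * E)
    rw [Matrix.conjTranspose_mul, Matrix.conjTranspose_conjTranspose, hEH] at this
    rw [hZ, ← Matrix.mul_assoc, Matrix.mul_assoc (E * Y), this, Complex.ofReal_re]
    positivity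
  have u4 : (P * E * Z * E).trace.re ≤ ‖E‖ * (‖E‖ / g) := by
    have := trace_conjTranspose_mul_self (Yᴴ * E * U)
    have e : (P * E * Z * E).trace = ((Yᴴ * E * U)ᴴ * (Yᴴ * E * U)).trace := by
      rw [Matrix.conjTranspose_mul, Matrix.conjTranspose_mul, Matrix.conjTranspose_conjTranspose,
        hEH, hP, Matrix.mul_assoc U, Matrix.mul_assoc U, Matrix.mul_assoc U, Matrix.trace_mul_comm]
      simp only [hZ, Matrix.mul_assoc]
    rw [e, this, Complex.ofReal_re]
    calc ‖Yᴴ * E * U‖ ^ 2 ≤ ((√g)⁻¹ * ‖E‖) ^ 2 := by gcongr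
      _ = ‖E‖ * ((√g)⁻¹ * ((√g)⁻¹ * ‖E‖)) := by ring
      _ = _ := by rw [hsq]
  have u5 : (E * Z * E * Z * E).trace.re ≤ ‖E‖ * (‖E‖ / g) ^ 2 := by
    have e : (E * Z * E * Z * E).trace = (((Yᴴ * E) * (E * Y)) * (Yᴴ * E * Y)).trace := by
      rw [Matrix.trace_mul_comm (Yᴴ * E * (E * Y))]
      have : E * Z * E * Z * E = E * Y * (Yᴴ * E * Y * (Yᴴ * E)) := by
        simp only [hZ, Matrix.mul_assoc]
      rw [this, Matrix.trace_mul_comm]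
      simp only [Matrix.mul_assoc]
    rw [e]
    refine (le_abs_self _).trans ((abs_re_trace_mul_le _ _).trans ?_)
    have h1 := Matrix.frobenius_norm_mul (Yᴴ * E) (E * Y)
    calc ‖Yᴴ * E * (E * Y)‖ * ‖Yᴴ * E * Y‖
        ≤ (((√g)⁻¹ * ‖E‖) * ((√g)⁻¹ * ‖E‖)) * (‖E‖ / g) := by
          gcongr
          exact h1.trans (by gcongr)
      _ = ‖E‖ * ((√g)⁻¹ * ((√g)⁻¹ * ‖E‖)) * (‖E‖ / g) := by ring
      _ = _ := by rw [hsq]; ring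
  have u6 := (neg_le_abs _).trans u2
  rw [hN', u1]
  simp only [Complex.sub_re, Complex.add_re, Complex.ofReal_re, Complex.mul_re, Complex.re_ofNat,
    Complex.im_ofNat, zero_mul, sub_zero]
  linarith

/-- `V * Vᴴ` is only nearly a projection, so the square of `1 - V * Vᴴ` must be expanded in full;
this is where `2Π - Π²` comes from. -/
theorem norm_mul_one_sub_sq (A : Matrix n n ℂ) [DecidableEq n] (V : Matrix n k ℂ) :
    ‖A * (1 - V * Vᴴ)‖ ^ 2
      = ‖A‖ ^ 2 - (Aᴴ * A * ((2 : ℂ) • (V * Vᴴ) - V * Vᴴ * (V * Vᴴ))).trace.re := by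
  have h := trace_conjTranspose_mul_self (A * (1 - V * Vᴴ))
  have h2 := trace_conjTranspose_mul_self A
  have e : ((A * (1 - V * Vᴴ))ᴴ * (A * (1 - V * Vᴴ))).trace
      = (Aᴴ * A).trace - (Aᴴ * A * ((2 : ℂ) • (V * Vᴴ) - V * Vᴴ * (V * Vᴴ))).trace := by
    have hH : (1 - V * Vᴴ)ᴴ = 1 - V * Vᴴ := by simp
    rw [Matrix.conjTranspose_mul, hH, Matrix.mul_assoc, Matrix.trace_mul_comm, ← Matrix.trace_sub]
    congr 1
    rw [two_smul]
    noncomm_ring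
  rw [h, h2] at e
  have := congrArg Complex.re e
  simpa only [Complex.sub_re, Complex.ofReal_re] using this

end Reconstruction

/-- The reconstruction error of the truncated singular value decomposition of `W`. The type `K`
stands for the set of the kept indices. -/
theorem reconstruction_bounds {n p : ℕ} (A : Matrix (Fin n) (Fin n) ℂ)
    (S : Matrix (Fin p) (Fin n) ℂ) {W X Y : Matrix (Fin p) (Fin p) ℂ} {σ : Fin p → ℝ}
    (hW : IsSVD W X Y σ) {g : ℝ} (hg : 0 < g) {K : Type*} [Fintype K] [DecidableEq K]
    {f : K → Fin p} (hf : Function.Injective f)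
    (hfK : ∀ k, (∃ x, f x = k) ↔ k.val < A.rank ∧ ¬ σ k ^ 2 < g)
    {V : Matrix (Fin n) K ℂ} (hV : ∀ a x, V a x = (Sᴴ *ᵥ X.col (f x)) a / (σ (f x) : ℂ)) :
    ‖Vᴴ * V - 1‖ ≤ ‖S * Sᴴ - W * Wᴴ‖ / g ∧
    ‖A * (1 - V * Vᴴ)‖ ^ 2 ≤ A.rank * g
      + (‖Sᴴ * S - Aᴴ * A‖ + ‖S * Sᴴ - W * Wᴴ‖) * (2 * √A.rank
        + 2 * (‖S * Sᴴ - W * Wᴴ‖ / g) + (‖S * Sᴴ - W * Wᴴ‖ / g) ^ 2) := by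
  have hX : Xᴴ * X = 1 := Matrix.mem_unitaryGroup_iff'.1 hW.left_unitary
  have hY : Yᴴ * Y = 1 := Matrix.mem_unitaryGroup_iff'.1 hW.right_unitary
  have hprop : ∀ x, (f x).val < A.rank ∧ ¬ σ (f x) ^ 2 < g := fun x => (hfK _).1 ⟨x, rfl⟩
  have hcard : (Fintype.card K : ℝ) ≤ A.rank := by
    have := Fintype.card_le_of_injective
      (fun x : K => (⟨(f x).val, (hprop x).1⟩ : Fin A.rank))
      (fun x y h => hf (Fin.ext (by simpa using h)))
    rw [Fintype.card_fin] at this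
    exact_mod_cast this
  have hBX : W * Wᴴ * X = X * Matrix.diagonal fun k => ((σ k : ℂ) ^ 2) := by
    have hD : (Matrix.diagonal fun k => (σ k : ℂ))ᴴ = Matrix.diagonal fun k => (σ k : ℂ) := by
      rw [Matrix.diagonal_conjTranspose]; congr 1; ext k; simp
    have hDD : (Matrix.diagonal fun k => (σ k : ℂ)) * (Matrix.diagonal fun k => (σ k : ℂ))
        = Matrix.diagonal fun k => ((σ k : ℂ) ^ 2) := by
      rw [Matrix.diagonal_mul_diagonal]; congr 1; ext k; rw [sq]
    rw [← hDD, hW.eq_mul, Matrix.conjTranspose_mul, Matrix.conjTranspose_mul,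
      Matrix.conjTranspose_conjTranspose, hD]
    set D := Matrix.diagonal fun k => (σ k : ℂ)
    calc _ = X * D * (Yᴴ * Y) * D * (Xᴴ * X) := by simp only [Matrix.mul_assoc]
      _ = _ := by rw [hX, hY]; simp only [Matrix.mul_assoc, Matrix.mul_one]
  set U : Matrix (Fin p) K ℂ := X.submatrix id f with hUdef
  have hU : Uᴴ * U = 1 := by
    rw [hUdef, Matrix.conjTranspose_submatrix, ← Matrix.submatrix_mul _ _ _ id _
      Function.bijective_id, hX, Matrix.submatrix_one _ hf]
  have hBU : W * Wᴴ * U = U * Matrix.diagonal fun x => ((σ (f x) : ℂ) ^ 2) := by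
    ext a x
    have := congrFun (congrFun hBX a) (f x)
    rw [Matrix.mul_diagonal] at this
    rw [Matrix.mul_diagonal]
    simpa [hUdef, Matrix.mul_apply] using this
  have hVU : V = Sᴴ * (U * Matrix.diagonal fun x => ((σ (f x) : ℂ)⁻¹)) := by
    ext a x
    rw [hV, ← Matrix.mul_assoc, Matrix.mul_diagonal, div_eq_mul_inv]
    simp [hUdef, Matrix.mul_apply, Matrix.mulVec, dotProduct]
  obtain ⟨h1, h2⟩ := almost_isometry_of_eigenvectors (S := S) (B := W * Wᴴ) (by simp) hU hg
    (fun x => hW.nonneg (f x)) (fun x => not_lt.1 (hprop x).2) hBU hVU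
  refine ⟨h1, ?_⟩
  have h3 := norm_two_mul_sub_sq_le V h1
  have h4 := norm_sq_le_sum_singular A S hW
  have h5 := norm_mul_one_sub_sq A V
  set N := (2 : ℂ) • (V * Vᴴ) - V * Vᴴ * (V * Vᴴ)
  have h6 : (Sᴴ * S * N).trace.re = (Aᴴ * A * N).trace.re + ((Sᴴ * S - Aᴴ * A) * N).trace.re := by
    rw [Matrix.sub_mul, Matrix.trace_sub, Complex.sub_re, add_sub_cancel]
  have h7 := (le_abs_self _).trans (abs_re_trace_mul_le (Sᴴ * S - Aᴴ * A) N)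
  -- At most `rank A` values are discarded, each with `σ² < g`.
  have h8 : ∑ k with k.val < A.rank, σ k ^ 2 ≤ ∑ x, σ (f x) ^ 2 + A.rank * g := by
    rw [← Finset.sum_filter_add_sum_filter_not _ (fun k => ¬ σ k ^ 2 < g)]
    gcongr
    · rw [Finset.filter_filter]
      refine le_of_eq ?_
      refine Eq.trans ?_ (Finset.sum_map Finset.univ ⟨f, hf⟩ fun k => σ k ^ 2)
      refine Finset.sum_congr ?_ fun _ _ => rfl
      ext k
      simp only [Finset.mem_filter, Finset.mem_univ, true_and, Finset.mem_map,
        Function.Embedding.coeFn_mk, hfK]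
    · refine (Finset.sum_le_card_nsmul _ _ g fun k hk => ?_).trans ?_
      · have := (Finset.mem_filter.1 hk).2
        push Not at this
        exact this.le
      · rw [nsmul_eq_mul]
        gcongr
        refine (Finset.card_le_card (Finset.filter_subset _ _)).trans ?_
        have := Finset.card_le_card_of_injOn (s := Finset.univ.filter fun k : Fin p =>
          k.val < A.rank) (t := Finset.range A.rank) Fin.val (fun k hk => by simpa using hk)
          Fin.val_injective.injOn
        simpa using this
  set D1 := ‖Sᴴ * S - Aᴴ * A‖
  set D2 := ‖S * Sᴴ - W * Wᴴ‖
  set κ := D2 / g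
  have hD1 : 0 ≤ D1 := norm_nonneg _
  have hD2 : 0 ≤ D2 := norm_nonneg _
  have hκ : 0 ≤ κ := div_nonneg hD2 hg.le
  have hs : √(Fintype.card K) ≤ √A.rank := Real.sqrt_le_sqrt hcard
  have h9 : D1 * ‖N‖ ≤ D1 * (√A.rank + κ ^ 2) := by
    gcongr
    linarith
  have h10 : D2 * (√(Fintype.card K) + 2 * κ + κ ^ 2) ≤ D2 * (√A.rank + 2 * κ + κ ^ 2) := by
    gcongr
  -- The stated bound gives `D1` the same factor as `D2`; the surplus `2 * D1 * κ` is nonnegative.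
  have h11 : 0 ≤ D1 * κ := by positivity
  linarith

/-- With `Π = VV†` and `A` Hermitian, `ΠAΠ - A = -Π(A(1-Π)) - (A(1-Π))†`. The first term has norm at
most `(1 + κ)δ`, the second at most `δ`. -/
theorem norm_conj_sub_le {n : ℕ} {K : Type*} [Fintype K] [DecidableEq K]
    {A : Matrix (Fin n) (Fin n) ℂ} (hA : A.IsHermitian) (V : Matrix (Fin n) K ℂ) {κ δ : ℝ}
    (hκ : ‖Vᴴ * V - 1‖ ≤ κ) (hδ : ‖A * (1 - V * Vᴴ)‖ ≤ δ) :
    ‖V * Vᴴ * A * V * Vᴴ - A‖ ≤ δ * (2 + κ) := by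
  have hκ0 : 0 ≤ κ := (norm_nonneg _).trans hκ
  have e : V * Vᴴ * A * V * Vᴴ - A = -(V * Vᴴ * (A * (1 - V * Vᴴ))) - (A * (1 - V * Vᴴ))ᴴ := by
    rw [Matrix.conjTranspose_mul, hA.eq, Matrix.conjTranspose_sub, Matrix.conjTranspose_one,
      Matrix.conjTranspose_mul, Matrix.conjTranspose_conjTranspose]
    simp only [Matrix.mul_sub, Matrix.sub_mul, Matrix.mul_one, Matrix.one_mul, Matrix.mul_assoc]
    abel
  rw [e]
  refine (norm_sub_le _ _).trans ?_
  rw [norm_neg, Matrix.frobenius_norm_conjTranspose]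
  have := norm_mul_conjTranspose_mul_le V hκ (A * (1 - V * Vᴴ))
  have h2 : (1 + κ) * ‖A * (1 - V * Vᴴ)‖ ≤ (1 + κ) * δ := by gcongr
  linarith

/-! ### Bounds on norms, singular values and ranks -/

theorem norm_sum_sq_le {τ : ℕ} {E : Type*} [SeminormedAddCommGroup E] (M : Fin τ → E) :
    ‖∑ ℓ, M ℓ‖ ^ 2 ≤ τ * ∑ ℓ, ‖M ℓ‖ ^ 2 := by
  calc ‖∑ ℓ, M ℓ‖ ^ 2 ≤ (∑ ℓ, ‖M ℓ‖) ^ 2 := by gcongr; exact norm_sum_le _ _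
    _ ≤ _ := by simpa using sq_sum_le_card_mul_sum_sq (s := Finset.univ) (f := fun ℓ => ‖M ℓ‖)

theorem singular_sq_le {p : ℕ} {W X Y : Matrix (Fin p) (Fin p) ℂ} {σ : Fin p → ℝ}
    (hW : IsSVD W X Y σ) (k : Fin p) : σ k ^ 2 ≤ ‖W‖ ^ 2 := by
  have hX : Xᴴ * X = 1 := Matrix.mem_unitaryGroup_iff'.1 hW.left_unitary
  have hY : Yᴴ * Y = 1 := Matrix.mem_unitaryGroup_iff'.1 hW.right_unitary
  have h : Matrix.diagonal (fun k => (σ k : ℂ)) = Xᴴ * W * Y := by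
    rw [hW.eq_mul]
    calc _ = (Xᴴ * X) * Matrix.diagonal (fun k => (σ k : ℂ)) * (Yᴴ * Y) := by
          rw [hX, hY, Matrix.one_mul, Matrix.mul_one]
      _ = _ := by simp only [Matrix.mul_assoc]
  have h2 : ‖Matrix.diagonal (fun k => (σ k : ℂ))‖ ^ 2 ≤ ‖W‖ ^ 2 := by
    rw [h]
    gcongr
    exact (norm_mul_isometry_le Y hY _).trans (norm_conjTranspose_mul_le X hX W)
  rw [frobenius_sq_eq_sum] at h2
  refine le_trans ?_ h2
  calc σ k ^ 2 = ‖Matrix.diagonal (fun k => (σ k : ℂ)) k k‖ ^ 2 := by simp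
    _ ≤ ∑ j, ‖Matrix.diagonal (fun k => (σ k : ℂ)) k j‖ ^ 2 :=
      Finset.single_le_sum (f := fun j => ‖Matrix.diagonal (fun k => (σ k : ℂ)) k j‖ ^ 2)
        (fun _ _ => by positivity) (Finset.mem_univ k)
    _ ≤ _ := Finset.single_le_sum
        (f := fun i => ∑ j, ‖Matrix.diagonal (fun k => (σ k : ℂ)) i j‖ ^ 2)
        (fun _ _ => by positivity) (Finset.mem_univ k)

/-- If `H` projects onto the row space, then `A = A * H`. A contraction shortens every column of
`H`, and `‖H‖²` is the rank. -/
theorem norm_sq_le_rank {n : ℕ} (A : Matrix (Fin n) (Fin n) ℂ)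
    (hnorm : ‖Matrix.toEuclideanCLM (n := Fin n) (𝕜 := ℂ) A‖ ≤ 1) : ‖A‖ ^ 2 ≤ A.rank := by
  obtain ⟨H, h1, h2, h3, -, h5⟩ := exists_projection Aᴴ
  have hA : A = A * H := by
    have := congrArg Matrix.conjTranspose h3
    rw [Matrix.conjTranspose_mul, Matrix.conjTranspose_conjTranspose, h1] at this
    exact this.symm
  have hH : ‖H‖ ^ 2 = A.rank := by
    rw [norm_sq_of_projection h1 h2, h5, Matrix.rank_conjTranspose]; simp
  calc ‖A‖ ^ 2 = ∑ j, ∑ i, ‖(A * H) i j‖ ^ 2 := by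
        rw [← hA, frobenius_sq_eq_sum, Finset.sum_comm]
    _ ≤ ∑ j, ∑ i, ‖H i j‖ ^ 2 := ?_
    _ = A.rank := by rw [← hH, frobenius_sq_eq_sum, Finset.sum_comm]
  refine Finset.sum_le_sum fun j _ => ?_
  have := (Matrix.toEuclideanCLM (n := Fin n) (𝕜 := ℂ) A).le_of_opNorm_le hnorm
    (WithLp.toLp 2 (H.col j))
  have h6 := pow_le_pow_left₀ (norm_nonneg _) this 2
  rw [one_mul, EuclideanSpace.norm_sq_eq, EuclideanSpace.norm_sq_eq] at h6
  simpa [Matrix.mulVec, dotProduct, Matrix.mul_apply] using h6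

theorem rank_add_le_add {n : ℕ} (A B : Matrix (Fin n) (Fin n) ℂ) :
    (A + B).rank ≤ A.rank + B.rank := by
  simp only [Matrix.rank]
  refine le_trans (Submodule.finrank_mono ?_) (Submodule.finrank_add_le_finrank_add_finrank _ _)
  rw [Matrix.mulVecLin_add]
  rintro _ ⟨x, rfl⟩
  exact Submodule.add_mem_sup ⟨x, rfl⟩ ⟨x, rfl⟩

theorem rank_sum_le {τ n : ℕ} (A : Fin τ → Matrix (Fin n) (Fin n) ℂ) :
    (∑ ℓ, A ℓ).rank ≤ ∑ ℓ, (A ℓ).rank := by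
  induction τ with
  | zero => simp
  | succ τ ih =>
    rw [Fin.sum_univ_succ, Fin.sum_univ_succ]
    exact (rank_add_le_add _ _).trans (by gcongr; exact ih _)

/-! ### Second moments of independent sums, Gram matrices of sampled rows, Markov's inequality -/

theorem sum_fin_succ_fun {ι M : Type*} [Fintype ι] [AddCommMonoid M] {p : ℕ}
    (F : (Fin (p + 1) → ι) → M) : ∑ f, F f = ∑ i, ∑ f : Fin p → ι, F (Fin.cons i f) := by
  rw [← Fintype.sum_prod_type']
  exact (Fintype.sum_equiv (Fin.consEquiv fun _ => ι) _ _ fun _ => rfl).symm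

theorem sum_prod_eq_one {ι : Type*} [Fintype ι] [DecidableEq ι] {w : ι → ℝ} (hw : ∑ i, w i = 1)
    (p : ℕ) : ∑ f : Fin p → ι, ∏ s, w (f s) = 1 := by
  rw [← Fintype.prod_sum (f := fun (_ : Fin p) j => w j)]
  simp [hw]

/-- The second moment of a sum of independent, identically distributed, centered vectors. -/
theorem second_moment_sum {ι E : Type*} [Fintype ι] [DecidableEq ι] [NormedAddCommGroup E]
    [InnerProductSpace ℝ E] {w : ι → ℝ} (hw : ∑ i, w i = 1) {h : ι → E} (hh : ∑ i, w i • h i = 0)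
    (p : ℕ) :
    ∑ f : Fin p → ι, (∏ s, w (f s)) * ‖∑ t, h (f t)‖ ^ 2 = p * ∑ i, w i * ‖h i‖ ^ 2 := by
  induction p with
  | zero => simp
  | succ p ih =>
    rw [sum_fin_succ_fun]
    have h1 : ∀ (i : ι) (f : Fin p → ι),
        (∏ s, w ((Fin.cons i f : Fin (p + 1) → ι) s))
          * ‖∑ t, h ((Fin.cons i f : Fin (p + 1) → ι) t)‖ ^ 2
        = (∏ s, w (f s)) * (w i * ‖h i‖ ^ 2) + w i * ((∏ s, w (f s)) * ‖∑ t, h (f t)‖ ^ 2)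
          + 2 * (∏ s, w (f s)) * inner ℝ (w i • h i) (∑ t, h (f t)) := by
      intro i f
      simp only [Fin.prod_univ_succ, Fin.sum_univ_succ, Fin.cons_zero, Fin.cons_succ]
      rw [norm_add_sq_real, real_inner_smul_left]
      ring
    simp only [h1, Finset.sum_add_distrib]
    -- The cross terms vanish because the new summand is independent of the others and centered.
    have h2 : ∑ i, ∑ f : Fin p → ι, 2 * (∏ s, w (f s)) * inner ℝ (w i • h i) (∑ t, h (f t))
        = 0 := by
      rw [Finset.sum_comm]
      refine Finset.sum_eq_zero fun f _ => ?_
      rw [← Finset.mul_sum, ← sum_inner, hh, inner_zero_left, mul_zero]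
    have h3 : ∑ i, ∑ f : Fin p → ι, (∏ s, w (f s)) * (w i * ‖h i‖ ^ 2)
        = ∑ i, w i * ‖h i‖ ^ 2 := by
      refine Finset.sum_congr rfl fun i _ => ?_
      rw [← Finset.sum_mul, sum_prod_eq_one hw, one_mul]
    have h4 : ∑ i, ∑ f : Fin p → ι, w i * ((∏ s, w (f s)) * ‖∑ t, h (f t)‖ ^ 2)
        = p * ∑ i, w i * ‖h i‖ ^ 2 := by
      simp only [← Finset.mul_sum]
      rw [ih, ← Finset.sum_mul, hw, one_mul]
    rw [h2, h3, h4]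
    push_cast
    ring

theorem variance_sum_le {ι E : Type*} [Fintype ι] [DecidableEq ι] [NormedAddCommGroup E]
    [InnerProductSpace ℝ E] {w : ι → ℝ} (hw : ∑ i, w i = 1) {g : ι → E} {m : E}
    (hg : ∑ i, w i • g i = m) (p : ℕ) :
    ∑ f : Fin p → ι, (∏ s, w (f s)) * ‖∑ t, g (f t) - (p : ℝ) • m‖ ^ 2
      ≤ p * ∑ i, w i * ‖g i‖ ^ 2 := by
  have h0 : ∑ i, w i • (g i - m) = 0 := by
    simp only [smul_sub, Finset.sum_sub_distrib]
    rw [hg, ← Finset.sum_smul, hw, one_smul, sub_self]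
  have h1 := second_moment_sum hw h0 p
  have h2 : ∀ f : Fin p → ι, ∑ t, (g (f t) - m) = ∑ t, g (f t) - (p : ℝ) • m := by
    intro f
    simp [Finset.sum_sub_distrib, Nat.cast_smul_eq_nsmul]
  simp only [h2] at h1
  rw [h1]
  refine mul_le_mul_of_nonneg_left ?_ (Nat.cast_nonneg p)
  have h3 : ∑ i, w i * ‖g i - m‖ ^ 2 = ∑ i, w i * ‖g i‖ ^ 2 - ‖m‖ ^ 2 := by
    have : ∀ i, w i * ‖g i - m‖ ^ 2
        = w i * ‖g i‖ ^ 2 - 2 * inner ℝ (w i • g i) m + w i * ‖m‖ ^ 2 := by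
      intro i
      rw [norm_sub_sq_real, real_inner_smul_left]
      ring
    simp only [this, Finset.sum_add_distrib, Finset.sum_sub_distrib]
    rw [← Finset.mul_sum, ← sum_inner, hg, real_inner_self_eq_norm_sq, ← Finset.sum_mul, hw]
    ring
  rw [h3]
  linarith [sq_nonneg ‖m‖]

/-- The matrix of the rescaled sampled rows of `M`. -/
def sampledRows {α β : Type*} {p : ℕ} (M : Matrix α β ℂ) (w : α → ℝ) (f : Fin p → α) :
    Matrix (Fin p) β ℂ :=
  Matrix.of fun t b => M (f t) b / (√((p : ℝ) * w (f t)) : ℝ)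

/-- Makes division by a zero weight harmless: the row in the numerator is zero as well. -/
theorem row_eq_zero {α β : Type*} [Fintype β] {M : Matrix α β ℂ} {w : α → ℝ} {c : ℝ}
    (hrow : ∀ i, ∑ b, ‖M i b‖ ^ 2 ≤ c * w i) {i : α} (hi : w i = 0) (b : β) : M i b = 0 := by
  have h := hrow i
  rw [hi, mul_zero] at h
  have h2 := (Finset.single_le_sum (f := fun b => ‖M i b‖ ^ 2) (fun _ _ => by positivity)
    (Finset.mem_univ b)).trans h
  simpa using le_antisymm h2 (by positivity)

/-- Length-square sampling of rows approximates the Gram matrix. -/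
theorem expected_gram_error {α β : Type*} [Fintype α] [DecidableEq α] [Fintype β] {p : ℕ}
    (hp : 0 < p) (M : Matrix α β ℂ) {w : α → ℝ} (hw0 : ∀ i, 0 ≤ w i) (hw : ∑ i, w i = 1) {c : ℝ}
    (hrow : ∀ i, ∑ b, ‖M i b‖ ^ 2 ≤ c * w i) :
    ∑ f : Fin p → α, (∏ s, w (f s)) * ‖(sampledRows M w f)ᴴ * sampledRows M w f - Mᴴ * M‖ ^ 2
      ≤ c ^ 2 / p := by
  have hp' : (p : ℂ) ≠ 0 := by exact_mod_cast hp.ne'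
  have hp'' : (0 : ℝ) < p := by exact_mod_cast hp
  set g : β → β → α → ℂ := fun a b i => star (M i a) * M i b / ((p : ℂ) * w i) with hg
  have hmean : ∀ a b, ∑ i, w i • g a b i = (p : ℂ)⁻¹ * (Mᴴ * M) a b := by
    intro a b
    rw [Matrix.mul_apply, Finset.mul_sum]
    -- The estimator is unbiased term by term: the weight cancels the denominator, or the row is
    -- zero.
    refine Finset.sum_congr rfl fun i _ => ?_
    simp only [hg, Matrix.conjTranspose_apply]
    by_cases hi : w i = 0
    · simp [row_eq_zero hrow hi]
    · have : (w i : ℂ) ≠ 0 := by exact_mod_cast hi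
      rw [Complex.real_smul]
      field_simp
  have hentry : ∀ (f : Fin p → α) a b,
      ((sampledRows M w f)ᴴ * sampledRows M w f - Mᴴ * M) a b
        = ∑ t, g a b (f t) - (p : ℝ) • ((p : ℂ)⁻¹ * (Mᴴ * M) a b) := by
    intro f a b
    rw [Matrix.sub_apply, Matrix.mul_apply, Complex.real_smul]
    congr 1
    · refine Finset.sum_congr rfl fun t _ => ?_
      have h : ((√((p : ℝ) * w (f t)) : ℝ) : ℂ) * (√((p : ℝ) * w (f t)) : ℝ) = p * w (f t) := by
        rw [← Complex.ofReal_mul, Real.mul_self_sqrt (mul_nonneg hp''.le (hw0 _))]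
        push_cast; rfl
      simp only [sampledRows, Matrix.conjTranspose_apply, Matrix.of_apply, star_div₀, hg]
      rw [div_mul_div_comm, ← h]
      simp
    · push_cast
      field_simp
  have hsum : ∑ f : Fin p → α, (∏ s, w (f s))
        * ‖(sampledRows M w f)ᴴ * sampledRows M w f - Mᴴ * M‖ ^ 2
      ≤ ∑ a, ∑ b, p * ∑ i, w i * ‖g a b i‖ ^ 2 := by
    simp only [frobenius_sq_eq_sum, Finset.mul_sum]
    rw [Finset.sum_comm]
    refine Finset.sum_le_sum fun a _ => ?_
    rw [Finset.sum_comm]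
    refine Finset.sum_le_sum fun b _ => ?_
    simp only [hentry]
    rw [← Finset.mul_sum]
    exact variance_sum_le hw (hmean a b) p
  refine hsum.trans ?_
  have hswap : ∑ a, ∑ b, (p : ℝ) * ∑ i, w i * ‖g a b i‖ ^ 2
      = ∑ i, p * w i * ∑ a, ∑ b, ‖g a b i‖ ^ 2 := by
    simp only [Finset.mul_sum, ← mul_assoc]
    rw [Finset.sum_comm' (t' := Finset.univ) (s' := fun _ => Finset.univ) (by simp)]
    rw [Finset.sum_comm]
    simp only [Finset.sum_comm (s := (Finset.univ : Finset β)) (t := (Finset.univ : Finset α))]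
  rw [hswap]
  calc ∑ i, p * w i * ∑ a, ∑ b, ‖g a b i‖ ^ 2 ≤ ∑ i, c ^ 2 / p * w i := by
        refine Finset.sum_le_sum fun i _ => ?_
        rcases (hw0 i).eq_or_lt with hi | hi
        · rw [← hi]; simp
        -- The summand for row `i` is a rescaled rank-one matrix, so its squared norm is a fourth
        -- power of the row norm; the row bound leaves `c² w_i / p`.
        · have h1 : ∑ a, ∑ b, ‖g a b i‖ ^ 2 = (∑ b, ‖M i b‖ ^ 2) ^ 2 / (p * w i) ^ 2 := by
            rw [sq (∑ b, ‖M i b‖ ^ 2), Finset.sum_mul_sum]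
            simp only [Finset.sum_div]
            refine Finset.sum_congr rfl fun a _ => Finset.sum_congr rfl fun b _ => ?_
            simp only [hg, norm_div, norm_mul, norm_star, div_pow, mul_pow, Complex.norm_natCast,
              Complex.norm_real, Real.norm_of_nonneg hi.le]
          have h2 : (∑ b, ‖M i b‖ ^ 2) ^ 2 ≤ (c * w i) ^ 2 :=
            pow_le_pow_left₀ (by positivity) (hrow i) 2
          rw [h1]
          calc p * w i * ((∑ b, ‖M i b‖ ^ 2) ^ 2 / (p * w i) ^ 2)
              ≤ p * w i * ((c * w i) ^ 2 / (p * w i) ^ 2) := by gcongr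
            _ = _ := by field_simp
    _ = c ^ 2 / p := by rw [← Finset.mul_sum, hw, mul_one]

/-- Markov's inequality, with the event checked only at outcomes of nonzero weight; at the others
the sampling denominators may vanish. -/
theorem markov_nine_tenths {Ω : Type*} [Fintype Ω] {o q : Ω → ℝ} (ho : ∀ ω, 0 ≤ o ω)
    (ho1 : ∑ ω, o ω = 1) (hq : ∀ ω, 0 ≤ q ω) {a : ℝ} (ha : 0 < a) (hqa : ∑ ω, o ω * q ω ≤ a)
    {E : Ω → Prop} [DecidablePred E] (hE : ∀ ω, o ω ≠ 0 → q ω ≤ 10 * a → E ω) :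
    9 / 10 ≤ ∑ ω, if E ω then o ω else 0 := by
  have h : ∀ ω, o ω - o ω * q ω / (10 * a) ≤ if E ω then o ω else 0 := by
    intro ω
    split_ifs with h
    · have : 0 ≤ o ω * q ω / (10 * a) := div_nonneg (mul_nonneg (ho ω) (hq ω)) (by positivity)
      linarith
    · by_cases h0 : o ω = 0
      · simp [h0]
      · have h1 : 10 * a < q ω := by
          by_contra! hc
          exact h (hE ω h0 hc)
        rw [sub_nonpos, le_div_iff₀ (by positivity)]
        exact mul_le_mul_of_nonneg_left h1.le (ho ω)
  refine le_trans ?_ (Finset.sum_le_sum fun ω _ => h ω)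
  rw [Finset.sum_sub_distrib, ho1, ← Finset.sum_div]
  have : (∑ ω, o ω * q ω) / (10 * a) ≤ 1 / 10 := by
    rw [div_le_iff₀ (by positivity)]
    linarith
  linarith

/-! ### The two sampling stages -/

section Sampling

variable {τ n p : ℕ} (A : Fin τ → Matrix (Fin n) (Fin n) ℂ)

theorem norm_rowVec_sq {m n : ℕ} (M : Matrix (Fin m) (Fin n) ℂ) (i : Fin m) :
    ‖rowVec M i‖ ^ 2 = ∑ j, ‖M i j‖ ^ 2 := by
  simp [rowVec, EuclideanSpace.norm_sq_eq]

theorem rowProb_nonneg (i : Fin n) : 0 ≤ rowProb A i := by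
  rw [rowProb_eq]; positivity

theorem sum_norm_sq_pos (hA : ∃ ℓ, A ℓ ≠ 0) : 0 < ∑ ℓ, ‖A ℓ‖ ^ 2 := by
  obtain ⟨ℓ, hℓ⟩ := hA
  exact Finset.sum_pos' (fun _ _ => by positivity) ⟨ℓ, Finset.mem_univ ℓ, by positivity⟩

theorem sum_norm_rowVec_sq (hA : ∃ ℓ, A ℓ ≠ 0) (i : Fin n) :
    ∑ ℓ, ‖rowVec (A ℓ) i‖ ^ 2 = (∑ ℓ, ‖A ℓ‖ ^ 2) * rowProb A i := by
  rw [rowProb_eq, mul_div_cancel₀ _ (sum_norm_sq_pos A hA).ne']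

theorem condColProb_eq (i j : Fin n) :
    condColProb A i j = (∑ k, ‖A k i j‖ ^ 2) / ∑ ℓ, ‖rowVec (A ℓ) i‖ ^ 2 := by
  rw [condColProb, Finset.sum_div]
  refine Finset.sum_congr rfl fun k _ => ?_
  simp only [lengthSquared]
  by_cases h0 : ‖rowVec (A k) i‖ ^ 2 = 0
  · have h1 : ‖A k i j‖ ^ 2 = 0 :=
      (Finset.sum_eq_zero_iff_of_nonneg (fun _ _ => by positivity)).1
        ((norm_rowVec_sq (A k) i).symm.trans h0) j (Finset.mem_univ j)
    simp [h0, h1]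
  · rw [div_mul_div_comm, mul_comm (‖rowVec (A k) i‖ ^ 2), mul_div_mul_right _ _ h0]
    simp [rowVec]

theorem colProb_nonneg (i : Fin p → Fin n) (j : Fin n) : 0 ≤ colProb A i j := by
  simp only [colProb, condColProb_eq]
  positivity

theorem sum_colProb (hp : 0 < p) {i : Fin p → Fin n} (hi : ∀ s, rowProb A (i s) ≠ 0) :
    ∑ j, colProb A i j = 1 := by
  have hp' : (p : ℝ) ≠ 0 := by exact_mod_cast hp.ne'
  simp only [colProb]
  rw [Finset.sum_comm]
  simp only [← Finset.mul_sum, sum_condColProb A _ (hi _)]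
  simp [hp']

theorem norm_matS_sq (i : Fin p → Fin n) (ℓ : Fin τ) (t : Fin p) (k : Fin n) :
    ‖matS A i ℓ t k‖ ^ 2 = ‖A ℓ (i t) k‖ ^ 2 / (p * rowProb A (i t)) := by
  rw [matS, Matrix.of_apply, norm_div, div_pow, Complex.norm_real, Real.norm_eq_abs, sq_abs,
    Real.sq_sqrt (mul_nonneg (Nat.cast_nonneg p) (rowProb_nonneg A _))]

theorem norm_matW_sq (i j : Fin p → Fin n) (ℓ : Fin τ) (s t : Fin p) :
    ‖matW A i j ℓ s t‖ ^ 2 = ‖matS A i ℓ s (j t)‖ ^ 2 / (p * colProb A i (j t)) := by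
  rw [matW, Matrix.of_apply, norm_div, div_pow, Complex.norm_real, Real.norm_eq_abs, sq_abs,
    Real.sq_sqrt (mul_nonneg (Nat.cast_nonneg p) (colProb_nonneg A _ _))]

/-- The law of the column indices is given by the column norms of the `S_ℓ`. -/
theorem sum_norm_matS_sq (hA : ∃ ℓ, A ℓ ≠ 0) (i : Fin p → Fin n) (j : Fin n) :
    ∑ t, ∑ ℓ, ‖matS A i ℓ t j‖ ^ 2 = (∑ ℓ, ‖A ℓ‖ ^ 2) * colProb A i j := by
  have hΦ := (sum_norm_sq_pos A hA).ne'
  rw [colProb, Finset.mul_sum]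
  refine Finset.sum_congr rfl fun t _ => ?_
  simp only [norm_matS_sq]
  rw [← Finset.sum_div, condColProb_eq, sum_norm_rowVec_sq A hA]
  rw [← mul_assoc, mul_one_div, div_mul_div_comm, mul_left_comm, mul_div_mul_left _ _ hΦ]

/-- The rescaling gives each sampled column, over all `ℓ`, the total squared norm `Φ / p` exactly.
So the cut-off of the algorithm is not random. -/
theorem sum_norm_matW_sq (hA : ∃ ℓ, A ℓ ≠ 0) (hp : 0 < p) {i j : Fin p → Fin n}
    (hj : ∀ s, colProb A i (j s) ≠ 0) : ∑ ℓ, ‖matW A i j ℓ‖ ^ 2 = ∑ ℓ, ‖A ℓ‖ ^ 2 := by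
  have hp' : (p : ℝ) ≠ 0 := by exact_mod_cast hp.ne'
  have h : ∑ ℓ, ‖matW A i j ℓ‖ ^ 2 = ∑ t, ∑ s, ∑ ℓ, ‖matW A i j ℓ s t‖ ^ 2 := by
    simp only [frobenius_sq_eq_sum]
    rw [Finset.sum_comm]
    conv_rhs => rw [Finset.sum_comm]
    refine Finset.sum_congr rfl fun s _ => ?_
    rw [Finset.sum_comm]
  have h2 : ∀ t, ∑ s, ∑ ℓ, ‖matW A i j ℓ s t‖ ^ 2 = (∑ ℓ, ‖A ℓ‖ ^ 2) / p := by
    intro t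
    simp only [norm_matW_sq, ← Finset.sum_div]
    rw [sum_norm_matS_sq A hA, mul_div_mul_right _ _ (hj t)]
  rw [h]
  simp only [h2]
  rw [Finset.sum_const, Finset.card_univ, Fintype.card_fin, nsmul_eq_mul, mul_div_cancel₀ _ hp']

theorem sum_matS_eq (i : Fin p → Fin n) :
    ∑ ℓ, matS A i ℓ = sampledRows (∑ ℓ, A ℓ) (rowProb A) i := by
  ext t k
  simp only [matS, sampledRows, Matrix.sum_apply, Matrix.of_apply, Finset.sum_div]

/-- Sampling columns of `S` is sampling rows of `Sᴴ`, so `expected_gram_error` serves both stages.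
-/
theorem conjTranspose_sum_matW_eq (i j : Fin p → Fin n) :
    (∑ ℓ, matW A i j ℓ)ᴴ = sampledRows (∑ ℓ, matS A i ℓ)ᴴ (colProb A i) j := by
  ext t k
  simp only [matW, sampledRows, Matrix.sum_apply, Matrix.of_apply, Matrix.conjTranspose_apply,
    star_sum, Finset.sum_div, star_div₀]
  simp

/-- The sum of the squared errors of `S† S ≈ A† A` and of `W W† ≈ S S†`. -/
def gramError (ω : (Fin p → Fin n) × (Fin p → Fin n)) : ℝ :=
  ‖(∑ ℓ, matS A ω.1 ℓ)ᴴ * (∑ ℓ, matS A ω.1 ℓ) - (∑ ℓ, A ℓ)ᴴ * ∑ ℓ, A ℓ‖ ^ 2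
    + ‖(∑ ℓ, matS A ω.1 ℓ) * (∑ ℓ, matS A ω.1 ℓ)ᴴ
      - (∑ ℓ, matW A ω.1 ω.2 ℓ) * (∑ ℓ, matW A ω.1 ω.2 ℓ)ᴴ‖ ^ 2

theorem expected_gramError_le (hA : ∃ ℓ, A ℓ ≠ 0) (hp : 0 < p) :
    ∑ ω : (Fin p → Fin n) × (Fin p → Fin n), outcomeProb A ω * gramError A ω
      ≤ 2 * ((τ * ∑ ℓ, ‖A ℓ‖ ^ 2) ^ 2 / p) := by
  set c := τ * ∑ ℓ, ‖A ℓ‖ ^ 2 with hc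
  have hrow : ∀ i, ∑ b, ‖(∑ ℓ, A ℓ) i b‖ ^ 2 ≤ c * rowProb A i := by
    intro i
    rw [hc, mul_assoc, ← sum_norm_rowVec_sq A hA]
    simp only [norm_rowVec_sq, Matrix.sum_apply]
    rw [Finset.sum_comm, Finset.mul_sum]
    exact Finset.sum_le_sum fun b _ => norm_sum_sq_le _
  have h1 := expected_gram_error (p := p) hp (∑ ℓ, A ℓ) (rowProb_nonneg A) (sum_rowProb A hA) hrow
  simp only [← sum_matS_eq] at h1
  have h2 : ∀ i : Fin p → Fin n, (∀ s, rowProb A (i s) ≠ 0) →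
      ∑ j : Fin p → Fin n, (∏ t, colProb A i (j t))
        * ‖(∑ ℓ, matS A i ℓ) * (∑ ℓ, matS A i ℓ)ᴴ
            - (∑ ℓ, matW A i j ℓ) * (∑ ℓ, matW A i j ℓ)ᴴ‖ ^ 2 ≤ c ^ 2 / p := by
    intro i hi
    have hcol : ∀ j, ∑ t, ‖(∑ ℓ, matS A i ℓ)ᴴ j t‖ ^ 2 ≤ c * colProb A i j := by
      intro j
      rw [hc, mul_assoc, ← sum_norm_matS_sq A hA, Finset.mul_sum]
      simp only [Matrix.conjTranspose_apply, norm_star, Matrix.sum_apply]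
      exact Finset.sum_le_sum fun b _ => norm_sum_sq_le _
    have h := expected_gram_error (p := p) hp (∑ ℓ, matS A i ℓ)ᴴ (colProb_nonneg A i)
      (sum_colProb A hp hi) hcol
    simp only [← conjTranspose_sum_matW_eq, Matrix.conjTranspose_conjTranspose] at h
    refine le_of_eq_of_le (Finset.sum_congr rfl fun j _ => ?_) h
    rw [norm_sub_rev]
  rw [Fintype.sum_prod_type]
  have h3 : ∀ i : Fin p → Fin n, ∑ j : Fin p → Fin n, outcomeProb A (i, j) * gramError A (i, j)
      ≤ (∏ s, rowProb A (i s))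
          * ‖(∑ ℓ, matS A i ℓ)ᴴ * (∑ ℓ, matS A i ℓ) - (∑ ℓ, A ℓ)ᴴ * ∑ ℓ, A ℓ‖ ^ 2
        + (∏ s, rowProb A (i s)) * (c ^ 2 / p) := by
    intro i
    simp only [outcomeProb, gramError, mul_assoc, ← Finset.mul_sum, mul_add,
      Finset.sum_add_distrib]
    -- `colProb A i` is known to have total mass one only if every sampled row has nonzero
    -- probability; otherwise the whole term has weight zero.
    by_cases h : ∏ s, rowProb A (i s) = 0
    · simp [h]
    · have hi : ∀ s, rowProb A (i s) ≠ 0 := fun s => Finset.prod_ne_zero_iff.1 h s (by simp)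
      have hP : 0 ≤ ∏ s, rowProb A (i s) := Finset.prod_nonneg fun s _ => rowProb_nonneg A _
      rw [← Finset.sum_mul, sum_prod_eq_one (sum_colProb A hp hi), one_mul]
      gcongr
      exact h2 i hi
  refine (Finset.sum_le_sum fun i _ => h3 i).trans ?_
  rw [Finset.sum_add_distrib, ← Finset.sum_mul, sum_prod_eq_one (sum_rowProb A hA)]
  linarith

end Sampling

/-! ### Constants and assembly -/

/-- Here `T`, `Φ`, `R` stand for `τ`, `∑ ‖A_ℓ‖²`, `rank A`. The discarded energy uses `1/(3·10⁶)` of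
`(ε/r²)²`, the Gram errors less than `10⁻⁵`; together they stay below `1/90000`. -/
theorem error_budget {T r ε Φ p D₁ D₂ R : ℝ} (hT : 1 ≤ T) (hr : 1 ≤ r) (hε : 0 < ε) (hΦ : 0 < Φ)
    (hΦle : Φ ≤ T * r) (hp : 2 * 10 ^ 20 * (T ^ 12 * r ^ 19 / ε ^ 6) ≤ p) (hD₁ : 0 ≤ D₁)
    (hD₂ : 0 ≤ D₂) (hD : D₁ ^ 2 + D₂ ^ 2 ≤ 20 * ((T * Φ) ^ 2 / p)) (hRle : R ≤ T * r)
    {γ κ : ℝ} (hγ : γ = ε ^ 2 / (3 * 10 ^ 6 * T ^ 2 * r ^ 6)) (hγT : γ ≤ T)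
    (hκ : κ = D₂ / (γ * Φ)) :
    κ ≤ ε / (300 * r ^ 2 * (T + 1)) ∧
    R * (γ * Φ) + (D₁ + D₂) * (2 * √R + 2 * κ + κ ^ 2) ≤ (ε / (300 * r ^ 2)) ^ 2 := by
  have hT0 : 0 < T := by linarith
  have hr0 : 0 < r := by linarith
  have hγ0 : 0 < γ := by rw [hγ]; positivity
  have hTr : 1 ≤ T * r := one_le_mul_of_one_le_of_one_le hT hr
  set s := D₁ + D₂ with hs
  have hs0 : 0 ≤ s := by positivity
  -- `√(40 / (2·10²⁰)) < 45 / 10¹¹`; one factor `1 / r` is not needed.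
  have hs1 : s ≤ 45 / 10 ^ 11 * (Φ * ε ^ 3 / (T ^ 5 * r ^ 9)) := by
    refine (pow_le_pow_iff_left₀ hs0 (by positivity) two_ne_zero).1 ?_
    have a1 : s ^ 2 ≤ 40 * ((T * Φ) ^ 2 / p) := by nlinarith [sq_nonneg (D₁ - D₂)]
    have a2 : (T * Φ) ^ 2 / p ≤ (T * Φ) ^ 2 / (2 * 10 ^ 20 * (T ^ 12 * r ^ 19 / ε ^ 6)) := by
      gcongr
    have a3 : (T * Φ) ^ 2 / (2 * 10 ^ 20 * (T ^ 12 * r ^ 19 / ε ^ 6))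
        = 1 / (2 * 10 ^ 20) * (Φ * ε ^ 3 / (T ^ 5 * r ^ 9)) ^ 2 * (1 / r) := by
      field_simp
    have a4 : 1 / r ≤ 1 := (div_le_one hr0).2 hr
    have a5 : 1 / (2 * 10 ^ 20) * (Φ * ε ^ 3 / (T ^ 5 * r ^ 9)) ^ 2 * (1 / r)
        ≤ 1 / (2 * 10 ^ 20) * (Φ * ε ^ 3 / (T ^ 5 * r ^ 9)) ^ 2 * 1 := by gcongr
    rw [mul_pow]
    have a6 : 0 ≤ (Φ * ε ^ 3 / (T ^ 5 * r ^ 9)) ^ 2 := by positivity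
    linarith
  set u := ε / (T ^ 2 * r ^ 3) with hu
  have hu0 : 0 < u := by positivity
  -- `u² = 3·10⁶ γ / T²` and `γ ≤ T`, so `u ≤ √(3·10⁶) < 1733`.
  have hu1 : u ≤ 1733 := by
    refine (pow_le_pow_iff_left₀ hu0.le (by norm_num) two_ne_zero).1 ?_
    have b1 : u ^ 2 = 3 * 10 ^ 6 * (γ / T) * (1 / T) := by
      rw [hu, hγ]; field_simp
    have b2 : γ / T ≤ 1 := (div_le_one hT0).2 hγT
    have b3 : 1 / T ≤ 1 := (div_le_one hT0).2 hT
    have b4 : γ / T * (1 / T) ≤ 1 := mul_le_one₀ b2 (by positivity) b3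
    rw [b1]
    linarith
  have hκ0 : 0 ≤ κ := by rw [hκ]; positivity
  have hκ1 : κ ≤ 135 / 10 ^ 5 * (ε / (T ^ 3 * r ^ 3)) := by
    have c1 : D₂ ≤ s := by linarith
    calc κ ≤ 45 / 10 ^ 11 * (Φ * ε ^ 3 / (T ^ 5 * r ^ 9)) / (γ * Φ) := by
          rw [hκ]; gcongr; exact c1.trans hs1
      _ = _ := by rw [hγ]; field_simp; norm_num
  refine ⟨hκ1.trans ?_, ?_⟩
  · have d1 : T + 1 ≤ 2 * (T ^ 3 * r) := by
      have : T ≤ T ^ 3 * r := by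
        have e1 : T ≤ T ^ 3 := le_self_pow₀ hT (by norm_num)
        have e2 : T ^ 3 * 1 ≤ T ^ 3 * r := by gcongr
        linarith
      linarith
    calc 135 / 10 ^ 5 * (ε / (T ^ 3 * r ^ 3))
        = 2 * (135 / 10 ^ 5) * 300 * (ε / (300 * r ^ 2 * (2 * (T ^ 3 * r)))) := by
          field_simp
      _ ≤ 1 * (ε / (300 * r ^ 2 * (T + 1))) := by
          gcongr
          norm_num
      _ = _ := one_mul _
  · have hκ2 : κ ≤ 235 / 100 := by
      have e1 : ε / (T ^ 3 * r ^ 3) = u * (1 / T) := by rw [hu]; field_simp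
      have e2 : 1 / T ≤ 1 := (div_le_one hT0).2 hT
      have e3 : u * (1 / T) ≤ 1733 * 1 := by gcongr
      rw [e1] at hκ1
      linarith
    have hsR : √R ≤ T * r := by
      refine Real.sqrt_le_iff.2 ⟨by positivity, ?_⟩
      nlinarith
    -- `2 + 2·2.35 + 2.35² < 12.25`, with `1 ≤ T * r`.
    have f1 : 2 * √R + 2 * κ + κ ^ 2 ≤ 1225 / 100 * (T * r) := by nlinarith
    have f2 : s * (2 * √R + 2 * κ + κ ^ 2)
        ≤ 45 / 10 ^ 11 * ((T * r) * ε ^ 3 / (T ^ 5 * r ^ 9)) * (1225 / 100 * (T * r)) := by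
      gcongr
      exact hs1.trans (by gcongr)
    have f3 : 45 / 10 ^ 11 * ((T * r) * ε ^ 3 / (T ^ 5 * r ^ 9)) * (1225 / 100 * (T * r))
        = 45 / 10 ^ 11 * (1225 / 100) * (u * (1 / T)) * (ε / r ^ 2) ^ 2 := by
      rw [hu]; field_simp
    have f4 : u * (1 / T) ≤ 1733 * 1 := by
      gcongr
      exact (div_le_one hT0).2 hT
    have f5 : 45 / 10 ^ 11 * (1225 / 100) * (u * (1 / T)) * (ε / r ^ 2) ^ 2
        ≤ 45 / 10 ^ 11 * (1225 / 100) * (1733 * 1) * (ε / r ^ 2) ^ 2 := by gcongr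
    have f6 : R * (γ * Φ) ≤ (T * r) * (γ * (T * r)) := by gcongr
    have f7 : (T * r) * (γ * (T * r)) = 1 / (3 * 10 ^ 6) * (ε / r ^ 2) ^ 2 := by
      rw [hγ]; field_simp
    have f8 : (ε / (300 * r ^ 2)) ^ 2 = 1 / 90000 * (ε / r ^ 2) ^ 2 := by
      field_simp; norm_num
    have f9 : 0 ≤ (ε / r ^ 2) ^ 2 := by positivity
    rw [f8]
    linarith

/-- For a threshold above `τ` the algorithm keeps nothing, and `A` itself is small enough. -/
theorem norm_sum_le_of_large {τ n r : ℕ} (A : Fin τ → Matrix (Fin n) (Fin n) ℂ) {ε : ℝ}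
    (hε : 0 < ε) (hτ : 1 ≤ τ) (hr : 1 ≤ r) (hΦ : ∑ ℓ, ‖A ℓ‖ ^ 2 ≤ (τ : ℝ) * r)
    (hγ : (τ : ℝ) < threshold τ r ε) :
    ‖∑ ℓ, A ℓ‖ ≤ ε / (300 * (r : ℝ) ^ 2) * (2 + ε / (300 * (r : ℝ) ^ 2 * ((τ : ℝ) + 1))) := by
  have hτ' : (1 : ℝ) ≤ τ := by exact_mod_cast hτ
  have hr' : (1 : ℝ) ≤ r := by exact_mod_cast hr
  have hτ0 : (0 : ℝ) < τ := by linarith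
  have hr0 : (0 : ℝ) < r := by linarith
  have hγ0 : 0 < threshold τ r ε := hτ0.trans hγ
  have h1 : ‖∑ ℓ, A ℓ‖ ≤ ε / (300 * (r : ℝ) ^ 2) * 2 := by
    refine (pow_le_pow_iff_left₀ (norm_nonneg _) (by positivity) two_ne_zero).1 ?_
    have h2 : ‖∑ ℓ, A ℓ‖ ^ 2 ≤ τ * (τ * r) := (norm_sum_sq_le A).trans (by gcongr)
    have h3 : (ε / (300 * (r : ℝ) ^ 2) * 2) ^ 2
        = 4 * (3 * 10 ^ 6) / 90000 * (threshold τ r ε * τ * (τ * r ^ 2)) := by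
      rw [threshold]; field_simp; norm_num
    have h4 : (τ : ℝ) * (τ * r) ≤ threshold τ r ε * τ * (τ * r ^ 2) := by
      have a1 : (1 : ℝ) * τ ≤ threshold τ r ε * τ := by gcongr; linarith
      have a2 : (τ : ℝ) * r ≤ τ * r ^ 2 := by gcongr; exact le_self_pow₀ hr' two_ne_zero
      have a3 : (1 : ℝ) * τ * (τ * r) ≤ threshold τ r ε * τ * (τ * r ^ 2) := by gcongr
      linarith
    have h5 : 0 ≤ threshold τ r ε * τ * (τ * r ^ 2) := le_trans (by positivity) h4
    rw [h3]
    linarith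
  refine h1.trans ?_
  gcongr
  have : 0 ≤ ε / (300 * (r : ℝ) ^ 2 * ((τ : ℝ) + 1)) := by positivity
  linarith

/-- The deterministic part: small errors of the two sampled Gram matrices imply the bound. -/
theorem error_le_of_gramError_le {τ n r p : ℕ} (A : Fin τ → Matrix (Fin n) (Fin n) ℂ)
    (hherm : ∀ ℓ, (A ℓ).IsHermitian)
    (hnorm : ∀ ℓ, ‖Matrix.toEuclideanCLM (n := Fin n) (𝕜 := ℂ) (A ℓ)‖ ≤ 1)
    (hrank : ∀ ℓ, (A ℓ).rank ≤ r) (hne : ∃ ℓ, A ℓ ≠ 0) {ε : ℝ} (hε : 0 < ε) (hτ : 1 ≤ τ)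
    (hr : 1 ≤ r) (hp0 : 0 < p) (hp : 2 * 10 ^ 20 * ((τ : ℝ) ^ 12 * (r : ℝ) ^ 19 / ε ^ 6) ≤ p)
    {i j : Fin p → Fin n} (hj : ∀ s, colProb A i (j s) ≠ 0)
    (hgram : gramError A (i, j) ≤ 10 * (2 * ((τ * ∑ ℓ, ‖A ℓ‖ ^ 2) ^ 2 / p)))
    {X Y : Matrix (Fin p) (Fin p) ℂ} {σ : Fin p → ℝ} (hW : IsSVD (∑ ℓ, matW A i j ℓ) X Y σ) :
    ‖matV A (threshold τ r ε) i j σ X * (matV A (threshold τ r ε) i j σ X)ᴴ * (∑ ℓ, A ℓ)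
        * matV A (threshold τ r ε) i j σ X * (matV A (threshold τ r ε) i j σ X)ᴴ - ∑ ℓ, A ℓ‖
      ≤ ε / (300 * (r : ℝ) ^ 2) * (2 + ε / (300 * (r : ℝ) ^ 2 * ((τ : ℝ) + 1))) := by
  classical
  have hτ' : (1 : ℝ) ≤ τ := by exact_mod_cast hτ
  have hr' : (1 : ℝ) ≤ r := by exact_mod_cast hr
  have hΦ := sum_norm_sq_pos A hne
  have hWΦ := sum_norm_matW_sq A hne hp0 hj
  have hΦle : ∑ ℓ, ‖A ℓ‖ ^ 2 ≤ (τ : ℝ) * r := by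
    calc ∑ ℓ, ‖A ℓ‖ ^ 2 ≤ ∑ _ℓ : Fin τ, (r : ℝ) := by
          refine Finset.sum_le_sum fun ℓ _ => (norm_sq_le_rank _ (hnorm ℓ)).trans ?_
          exact_mod_cast hrank ℓ
      _ = _ := by simp
  have hRle : ((∑ ℓ, A ℓ).rank : ℝ) ≤ τ * r := by
    have : (∑ ℓ, A ℓ).rank ≤ τ * r := by
      refine (rank_sum_le A).trans ((Finset.sum_le_sum fun ℓ _ => hrank ℓ).trans ?_)
      simp
    exact_mod_cast this
  have hherm' : (∑ ℓ, A ℓ).IsHermitian := by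
    rw [Matrix.IsHermitian, Matrix.conjTranspose_sum]
    exact Finset.sum_congr rfl fun ℓ _ => hherm ℓ
  have hγ0 : 0 < threshold τ r ε := by
    have : (0 : ℝ) < τ := by linarith
    have : (0 : ℝ) < r := by linarith
    rw [threshold]; positivity
  set γ := threshold τ r ε with hγ
  set V := matV A γ i j σ X with hV
  -- No upper bound on `ε` is assumed. If `γ > τ`, then `σ² ≤ ‖W‖² ≤ τ ∑ ‖W_ℓ‖²` is below the
  -- threshold for every `σ`, so `V` has no columns. Otherwise `γ ≤ τ`, as `error_budget` requires.
  rcases lt_or_ge (τ : ℝ) γ with hlarge | hsmall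
  · have hempty : IsEmpty (Kept A γ i j σ) := by
      refine ⟨fun k => k.2.2 ?_⟩
      calc σ k.1 ^ 2 ≤ ‖∑ ℓ, matW A i j ℓ‖ ^ 2 := singular_sq_le hW k.1
        _ ≤ τ * ∑ ℓ, ‖matW A i j ℓ‖ ^ 2 := norm_sum_sq_le _
        _ < γ * ∑ ℓ, ‖matW A i j ℓ‖ ^ 2 := mul_lt_mul_of_pos_right hlarge (hWΦ ▸ hΦ)
    have h0 : V * Vᴴ = 0 := by
      ext a b
      simp [Matrix.mul_apply]
    rw [h0, Matrix.zero_mul, Matrix.zero_mul, Matrix.zero_mul, zero_sub, norm_neg]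
    exact norm_sum_le_of_large A hε hτ hr hΦle hlarge
  · obtain ⟨h1, h2⟩ := reconstruction_bounds (∑ ℓ, A ℓ) (∑ ℓ, matS A i ℓ) hW
      (g := γ * ∑ ℓ, ‖A ℓ‖ ^ 2) (by positivity)
      (f := fun k : Kept A γ i j σ => k.1) (V := V) Subtype.val_injective
      (fun k => by
        rw [← hWΦ]
        exact ⟨fun ⟨x, hx⟩ => hx ▸ x.2, fun h => ⟨⟨k, h⟩, rfl⟩⟩)
      (fun a x => rfl)
    obtain ⟨h3, h4⟩ := error_budget hτ' hr' hε hΦ hΦle hp (norm_nonneg _) (norm_nonneg _)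
      (hgram.trans_eq (by ring)) hRle hγ hsmall rfl
    refine norm_conj_sub_le hherm' V (h1.trans h3) ?_
    refine (pow_le_pow_iff_left₀ (norm_nonneg _) (by positivity) two_ne_zero).1 ?_
    exact h2.trans h4

end WeightedSampling

end

open WeightedSampling in
theorem theorem3p2 {τ n r : ℕ} (A : Fin τ → Matrix (Fin n) (Fin n) ℂ)
    (hherm : ∀ ℓ, (A ℓ).IsHermitian)
    -- the spectral norm of each `A_ℓ` is at most 1
    (hnorm : ∀ ℓ, ‖Matrix.toEuclideanCLM (n := Fin n) (𝕜 := ℂ) (A ℓ)‖ ≤ 1)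
    (hrank : ∀ ℓ, (A ℓ).rank ≤ r)
    (hne : ∃ ℓ, A ℓ ≠ 0)
    (ε : ℝ) (hε : 0 < ε) :
    9 / 10 ≤ prob (p := sampleSize τ r ε) A (fun ω =>
      ∀ (X Y : Matrix (Fin (sampleSize τ r ε)) (Fin (sampleSize τ r ε)) ℂ)
        (σ : Fin (sampleSize τ r ε) → ℝ),
        IsSVD (∑ ℓ, matW A ω.1 ω.2 ℓ) X Y σ →
        let V := matV A (threshold τ r ε) ω.1 ω.2 σ X
        ‖V * Vᴴ * (∑ ℓ, A ℓ) * V * Vᴴ - ∑ ℓ, A ℓ‖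
          ≤ ε / (300 * (r : ℝ) ^ 2) * (2 + ε / (300 * (r : ℝ) ^ 2 * ((τ : ℝ) + 1)))) := by
  have hΦ := sum_norm_sq_pos A hne
  obtain ⟨ℓ₀, hℓ₀⟩ := hne
  have hτ : 1 ≤ τ := ℓ₀.pos
  -- Rank zero would force `A ℓ₀ = 0`.
  have hr : 1 ≤ r := by
    by_contra! h
    have h0 : (A ℓ₀).rank = 0 := by have := hrank ℓ₀; omega
    have h1 := norm_sq_le_rank _ (hnorm ℓ₀)
    rw [h0] at h1
    rw [Nat.cast_zero] at h1
    exact hℓ₀ (norm_eq_zero.1 (pow_eq_zero_iff two_ne_zero |>.1 (le_antisymm h1 (sq_nonneg _))))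
  have hτ0 : (0 : ℝ) < τ := by exact_mod_cast hτ
  have hr0 : (0 : ℝ) < r := by exact_mod_cast hr
  have hp : 2 * 10 ^ 20 * ((τ : ℝ) ^ 12 * (r : ℝ) ^ 19 / ε ^ 6) ≤ (sampleSize τ r ε : ℕ) :=
    Nat.le_ceil _
  have hp0 : 0 < sampleSize τ r ε := by
    rw [sampleSize, Nat.ceil_pos]
    positivity
  have hp0' : (0 : ℝ) < sampleSize τ r ε := by exact_mod_cast hp0
  classical
  unfold prob
  refine markov_nine_tenths (a := 2 * ((τ * ∑ ℓ, ‖A ℓ‖ ^ 2) ^ 2 / sampleSize τ r ε))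
    (fun ω => mul_nonneg (Finset.prod_nonneg fun s _ => rowProb_nonneg A _)
      (Finset.prod_nonneg fun t _ => colProb_nonneg A _ _))
    (sum_outcomeProb A ⟨ℓ₀, hℓ₀⟩ hp0) (q := gramError A)
    (fun ω => add_nonneg (sq_nonneg _) (sq_nonneg _)) (by positivity)
    (expected_gramError_le A ⟨ℓ₀, hℓ₀⟩ hp0) ?_
  rintro ⟨i, j⟩ ho hgram X Y σ hW
  have hj : ∀ s, colProb A i (j s) ≠ 0 := fun s =>
    Finset.prod_ne_zero_iff.1 (right_ne_zero_of_mul ho) s (Finset.mem_univ s)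
  exact error_le_of_gramError_le A hherm hnorm hrank ⟨ℓ₀, hℓ₀⟩ hε hτ hr hp0 hp hj hgram hW
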